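/- **Theorem 3.5.** Let $V$ be a finite-dimensional complex vector space (for instance $V=\mathbb{C}^n$) and let $L=\{L_1,\dots,L_l\}$, $l\ge 1$, be a central hyperplane arrangement in $V$, i.e. a finite set of pairwise distinct linear hyperplanes $L_i=\{f_i=0\}$, where the $f_i$ are non-zero linear forms. Put $\omega_i=\frac{df_i}{f_i}$ (this depends only on $L_i$) and $\omega_I=\omega_{i_1}\wedge\cdots\wedge\omega_{i_k}$ for $I=\{i_1<\cdots<i_k\}\subset\{1,\dots,l\}$. *Logarithmic forms.* $\Omega^p\langle L\rangle$ is the $\mathbb{C}$-vector space of $p$-forms on $V\setminus(L_1\cup\dots\cup L_l)$ that are $\mathbb{C}$-linear combinations of forms $\eta\wedge\omega_I$ with $\eta$ a holomorphic form on $V$ and $I\subset\{1,\dots,l\}$. With the exterior differential these spaces form a complex $\Omega^\bullet\langle L\rangle$. For $k\in\mathbb{Z}$, the weight filtration $W_k\Omega^\bullet\langle L\rangle$ is the subcomplex spanned by the forms $\eta\wedge\omega_I$ with $|I|\le k$ (so $W_k=0$ for $k<0$), and $\mathrm{gr}^W_k=W_k/W_{k-1}$. *Deletion, restriction, residue.*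 Let $L'=\{L_1,\dots,L_{l-1}\}$ be the deletion of $L$ with respect to $L_l$, an arrangement in $V$, and let $L''=\{L_l\cap L_i : 1\le i\le l-1\}$ (a set, without repetitions) be the restriction, an arrangement in $L_l$. Let $i:\Omega^\bullet\langle L'\rangle\to\Omega^\bullet\langle L\rangle$ be the natural inclusion. Every $\omega\in\Omega^p\langle L\rangle$ can be written $\omega=\alpha\wedge\omega_l+\beta$ with $\alpha$, $\beta$ logarithmic along $L'$, of degrees $p-1$ and $p$; the form $\mathrm{Res}_{L_l}(\omega)=2\pi i\,\alpha_{|L_l}\in\Omega^{p-1}\langle L''\rangle$ does not depend on the choices (for $p=0$ it is zero). This defines a morphism of complexes $\mathrm{Res}_{L_l}:\Omega^\bullet\langle L\rangle\to\Omega^{\bullet-1}\langle L''\rangle$, where $\Omega^{\bullet-1}\langle L''\rangle$ carries the exterior differential (with no sign change) and vanishes in degree $0$. It maps $W_k$ to $W_{k-1}$. Then the following are short exact sequences of complexes of $\mathbb{C}$-vector spaces: $$0\to\Omega^\bullet\langle L'\rangle\xrightarrow{\,i\,}\Omega^\bullet\langle L\rangle\xrightarrow{\mathrm{Res}_{L_l}}\Omega^{\bullet-1}\langle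 L''\rangle\to 0,$$ and, for every integer $k$, the two sequences induced by it, $$0\to W_k\Omega^\bullet\langle L'\rangle\xrightarrow{\,i\,} W_k\Omega^\bullet\langle L\rangle\xrightarrow{\mathrm{Res}_{L_l}} W_{k-1}\Omega^{\bullet-1}\langle L''\rangle\to 0,$$ $$0\to \mathrm{gr}^W_k\Omega^\bullet\langle L'\rangle\xrightarrow{\,i\,} \mathrm{gr}^W_k\Omega^\bullet\langle L\rangle\xrightarrow{\mathrm{Res}_{L_l}} \mathrm{gr}^W_{k-1}\Omega^{\bullet-1}\langle L''\rangle\to 0.$$ -/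

import Mathlib

universe u

set_option linter.unusedSectionVars false

namespace LogForms

open CategoryTheory

/-! ### Differential forms on open subsets of a complex vector space -/

section Forms

open ContinuousAlternatingMap

variable {E : Type u} [NormedAddCommGroup E] [NormedSpace ℂ E]

/-- Differential `p`-forms on `E` with complex linear alternating values, with no regularity imposed.
A form on an open subset `U` of `E` is represented by the form on `E` that extends it by zero. -/
def Form (E : Type u) [NormedAddCommGroup E] [NormedSpace ℂ E] (p : ℕ) : Type u :=
  E → E [⋀^Fin p]→L[ℂ] ℂ

noncomputable instance (p : ℕ) : AddCommGroup (Form E p) :=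
  inferInstanceAs (AddCommGroup (E → E [⋀^Fin p]→L[ℂ] ℂ))

noncomputable instance (p : ℕ) : Module ℂ (Form E p) :=
  inferInstanceAs (Module ℂ (E → E [⋀^Fin p]→L[ℂ] ℂ))

namespace Form

variable {p : ℕ} (a b : Form E p) (c : ℂ) (x : E)

@[ext] theorem ext {a b : Form E p} (h : ∀ x, a x = b x) : a = b := funext h

@[simp] theorem add_apply : (a + b) x = a x + b x := rfl

@[simp] theorem sub_apply : (a - b) x = a x - b x := rfl

@[simp] theorem neg_apply : (-a) x = -a x := rfl

@[simp] theorem smul_apply : (c • a) x = c • a x := rfl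

@[simp] theorem zero_apply : (0 : Form E p) x = 0 := rfl

end Form

/-- The exterior product `η ∧ θ` of a `p`-covector and a `1`-covector:
`(η ∧ θ)(v₀, …, v_p) = ∑ᵢ (-1)^(p+i) η(v₀, …, v̂ᵢ, …, v_p) θ(vᵢ)`, see `wedge_apply`. -/
noncomputable def wedge {p : ℕ} (η : E [⋀^Fin p]→L[ℂ] ℂ) (θ : E →L[ℂ] ℂ) :
    E [⋀^Fin (p + 1)]→L[ℂ] ℂ :=
  (-1 : ℂ) ^ p • alternatizeUncurryFin (θ.smulRight η)

theorem wedge_apply {p : ℕ} (η : E [⋀^Fin p]→L[ℂ] ℂ) (θ : E →L[ℂ] ℂ) (v : Fin (p + 1) → E) :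
    wedge η θ v = ∑ i : Fin (p + 1), (-1) ^ (p + (i : ℕ)) * (η (i.removeNth v) * θ (v i)) := by
  simp only [wedge, ContinuousAlternatingMap.smul_apply, alternatizeUncurryFin_apply, Finset.smul_sum]
  refine Finset.sum_congr rfl fun i _ => ?_
  simp only [ContinuousLinearMap.smulRight_apply, ContinuousAlternatingMap.smul_apply, zsmul_eq_mul,
    smul_eq_mul, pow_add]
  push_cast
  ring

theorem wedge_add {p : ℕ} (η η' : E [⋀^Fin p]→L[ℂ] ℂ) (θ : E →L[ℂ] ℂ) :
    wedge (η + η') θ = wedge η θ + wedge η' θ := by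
  ext v; simp only [wedge_apply, ContinuousAlternatingMap.add_apply, ← Finset.sum_add_distrib]
  exact Finset.sum_congr rfl fun i _ => by ring

theorem wedge_smul {p : ℕ} (c : ℂ) (η : E [⋀^Fin p]→L[ℂ] ℂ) (θ : E →L[ℂ] ℂ) :
    wedge (c • η) θ = c • wedge η θ := by
  ext v; simp only [wedge_apply, ContinuousAlternatingMap.smul_apply, smul_eq_mul, Finset.mul_sum]
  exact Finset.sum_congr rfl fun i _ => by ring

theorem wedge_smul_right {p : ℕ} (c : ℂ) (η : E [⋀^Fin p]→L[ℂ] ℂ) (θ : E →L[ℂ] ℂ) :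
    wedge η (c • θ) = c • wedge η θ := by
  ext v; simp only [wedge_apply, ContinuousAlternatingMap.smul_apply, _root_.smul_apply, smul_eq_mul, Finset.mul_sum]
  exact Finset.sum_congr rfl fun i _ => by ring

theorem wedge_zero_left {p : ℕ} (θ : E →L[ℂ] ℂ) :
    wedge (0 : E [⋀^Fin p]→L[ℂ] ℂ) θ = 0 := by
  ext v; simp [wedge_apply]

theorem wedge_zero_right {p : ℕ} (η : E [⋀^Fin p]→L[ℂ] ℂ)  :
    wedge η (0 : E →L[ℂ] ℂ) = 0 := by
  ext v; simp [wedge_apply]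

theorem alternatize_antisymm {p : ℕ} (f : E →L[ℂ] ℂ) (D : E →L[ℂ] E [⋀^Fin p]→L[ℂ] ℂ) :
    alternatizeUncurryFin (alternatizeUncurryFinCLM ℂ E ℂ ∘L
        (ContinuousLinearMap.smulRightL ℂ E (E [⋀^Fin p]→L[ℂ] ℂ) f ∘L D)) =
      - alternatizeUncurryFin (f.smulRight (alternatizeUncurryFin D)) := by
  have h := alternatizeUncurryFin_alternatizeUncurryFinCLM_comp_of_symmetric
    (f := ContinuousLinearMap.smulRightL ℂ E (E [⋀^Fin p]→L[ℂ] ℂ) f ∘L D + f.smulRight D)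
    (fun x y => by simp [add_comm])
  rw [ContinuousLinearMap.comp_add, alternatizeUncurryFin_add] at h
  rw [eq_neg_iff_add_eq_zero, ← h]
  congr 1
  congr 1
  ext u v
  simp

theorem wedge_wedge_comm {p : ℕ} (η : E [⋀^Fin p]→L[ℂ] ℂ) (θ θ' : E →L[ℂ] ℂ) :
    wedge (wedge η θ) θ' = - wedge (wedge η θ') θ := by
  have h := alternatize_antisymm θ (θ'.smulRight η)
  have e : alternatizeUncurryFinCLM ℂ E ℂ ∘L
        (ContinuousLinearMap.smulRightL ℂ E (E [⋀^Fin p]→L[ℂ] ℂ) θ ∘L (θ'.smulRight η)) =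
      θ'.smulRight (alternatizeUncurryFin (θ.smulRight η)) := by
    ext u v
    simp [alternatizeUncurryFin_apply, Finset.mul_sum]
  rw [e] at h
  have s : ∀ (c : ℂ) (f : E →L[ℂ] ℂ) (ω : E [⋀^Fin (p+1)]→L[ℂ] ℂ), f.smulRight (c • ω) = c • f.smulRight ω := by
    intro c f ω; ext; simp [mul_left_comm]
  simp only [wedge, s, alternatizeUncurryFin_smul, h, smul_neg]

theorem wedge_wedge_self {p : ℕ} (η : E [⋀^Fin p]→L[ℂ] ℂ) (θ : E →L[ℂ] ℂ) :
    wedge (wedge η θ) θ = 0 := by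
  have h := wedge_wedge_comm η θ θ
  ext v
  have hv := congrArg (fun ω => ω v) h
  simpa [self_eq_neg] using hv

theorem wedge_comp {F : Type u} [NormedAddCommGroup F] [NormedSpace ℂ F] {p : ℕ}
    (g : F →L[ℂ] E) (η : E [⋀^Fin p]→L[ℂ] ℂ) (θ : E →L[ℂ] ℂ) :
    (wedge η θ).compContinuousLinearMap g =
      wedge (η.compContinuousLinearMap g) (θ ∘L g) := by
  ext v
  simp only [ContinuousAlternatingMap.compContinuousLinearMap_apply, wedge_apply]
  rfl

theorem analyticAt_bilin {A B C D : Type*} [NormedAddCommGroup A] [NormedSpace ℂ A]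
    [NormedAddCommGroup B] [NormedSpace ℂ B] [NormedAddCommGroup C] [NormedSpace ℂ C]
    [NormedAddCommGroup D] [NormedSpace ℂ D] (T : A →L[ℂ] B →L[ℂ] C) {a : D → A} {b : D → B} {x : D}
    (ha : AnalyticAt ℂ a x) (hb : AnalyticAt ℂ b x) : AnalyticAt ℂ (fun y => T (a y) (b y)) x :=
  (T.analyticAt_bilinear (a x, b x)).comp₂ ha hb

theorem analyticAt_wedge {p : ℕ} {ω : E → E [⋀^Fin p]→L[ℂ] ℂ} {θ : E → E →L[ℂ] ℂ} {x : E}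
    (hω : AnalyticAt ℂ ω x) (hθ : AnalyticAt ℂ θ x) :
    AnalyticAt ℂ (fun y => wedge (ω y) (θ y)) x := by
  have h1 := analyticAt_bilin (C := E →L[ℂ] E [⋀^Fin p]→L[ℂ] ℂ)
    (ContinuousLinearMap.smulRightL ℂ E (E [⋀^Fin p]→L[ℂ] ℂ)) hθ hω
  exact ((((-1 : ℂ) ^ p • alternatizeUncurryFinCLM ℂ E ℂ :
    (E →L[ℂ] E [⋀^Fin p]→L[ℂ] ℂ) →L[ℂ] E [⋀^Fin (p + 1)]→L[ℂ] ℂ)).analyticAt _).comp h1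

theorem extDeriv_wedge_const {p : ℕ} {ω : E → E [⋀^Fin p]→L[ℂ] ℂ} (f : E →L[ℂ] ℂ) {x : E}
    (hω : DifferentiableAt ℂ ω x) :
    extDeriv (fun y => wedge (ω y) f) x = wedge (extDeriv ω x) f := by
  have h : HasFDerivAt (fun y => wedge (ω y) f)
      (((-1 : ℂ) ^ p • alternatizeUncurryFinCLM ℂ E ℂ) ∘L
        (ContinuousLinearMap.smulRightL ℂ E (E [⋀^Fin p]→L[ℂ] ℂ) f ∘L fderiv ℂ ω x)) x :=
    (((-1 : ℂ) ^ p • alternatizeUncurryFinCLM ℂ E ℂ) ∘L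
        (ContinuousLinearMap.smulRightL ℂ E (E [⋀^Fin p]→L[ℂ] ℂ) f)).hasFDerivAt.comp x
        hω.hasFDerivAt
  rw [extDeriv, h.fderiv, ContinuousLinearMap.smul_comp, alternatizeUncurryFin_smul,
    alternatize_antisymm, wedge, extDeriv, pow_succ]
  simp

theorem extDeriv_wedge_dlog {p : ℕ} {ω : E → E [⋀^Fin p]→L[ℂ] ℂ} (f : E →L[ℂ] ℂ) {x : E}
    (hω : DifferentiableAt ℂ ω x) (hx : f x ≠ 0) :
    extDeriv (fun y => wedge (ω y) ((f y)⁻¹ • f)) x = wedge (extDeriv ω x) ((f x)⁻¹ • f) := by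
  have hg : HasFDerivAt (fun y => (f y)⁻¹) ((-(f x ^ 2)⁻¹) • f) x := by
    have := (hasDerivAt_inv hx).comp_hasFDerivAt x f.hasFDerivAt
    exact this
  have hgω := hg.smul hω.hasFDerivAt
  have e : (fun y => wedge (ω y) ((f y)⁻¹ • f)) = fun y => wedge ((f y)⁻¹ • ω y) f := by
    funext y; rw [wedge_smul, wedge_smul_right]
  rw [e]
  change extDeriv (fun y => wedge (((fun y => (f y)⁻¹) • ω) y) f) x = _
  rw [extDeriv_wedge_const f hgω.differentiableAt, extDeriv, hgω.fderiv,
    alternatizeUncurryFin_add, wedge_add, alternatizeUncurryFin_smul, wedge_smul,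
    wedge_smul_right, extDeriv]
  have z : wedge (alternatizeUncurryFin (f.smulRight (ω x))) f = 0 := by
    have := wedge_wedge_self (ω x) f
    rw [show wedge (ω x) f = (-1 : ℂ) ^ p • alternatizeUncurryFin (f.smulRight (ω x)) from rfl,
      wedge_smul] at this
    ext v
    simpa using congrArg (fun ω => ω v) this
  have s : ((-(f x ^ 2)⁻¹) • f).smulRight (ω x) = (-(f x ^ 2)⁻¹) • f.smulRight (ω x) := by
    ext; simp [mul_assoc]
  rw [s, alternatizeUncurryFin_smul, wedge_smul, z]
  ext v
  simp

end Forms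

section Forms2

open ContinuousAlternatingMap

variable {E : Type u} [NormedAddCommGroup E] [NormedSpace ℂ E]

theorem analyticAt_extDeriv {p : ℕ} {ω : E → E [⋀^Fin p]→L[ℂ] ℂ} {x : E} (hω : AnalyticAt ℂ ω x) :
    AnalyticAt ℂ (extDeriv ω) x :=
  AnalyticAt.comp (g := (alternatizeUncurryFinCLM ℂ E ℂ :
    (E →L[ℂ] E [⋀^Fin p]→L[ℂ] ℂ) →L[ℂ] E [⋀^Fin (p + 1)]→L[ℂ] ℂ))
    (ContinuousLinearMap.analyticAt _ _) hω.fderiv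

/-- The restriction of a form to `U` (extended by zero outside `U`). -/
noncomputable def cut (U : Set E) {p : ℕ} : Form E p →ₗ[ℂ] Form E p where
  toFun ω := U.indicator ω
  map_add' _ _ := Set.indicator_add U _ _
  map_smul' c ω := by
    refine Form.ext fun x => ?_
    have key : ∀ f : E → E [⋀^Fin p]→L[ℂ] ℂ,
        U.indicator (fun y => c • f y) x = c • U.indicator f x := fun f => by
      by_cases hx : x ∈ U
      · rw [Set.indicator_of_mem hx, Set.indicator_of_mem hx]
      · rw [Set.indicator_of_notMem hx, Set.indicator_of_notMem hx]; ext v; simp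
    exact key ω

theorem cut_of_mem {U : Set E} {p : ℕ} (ω : Form E p) {x : E} (hx : x ∈ U) : cut U ω x = ω x :=
  Set.indicator_of_mem hx _

theorem cut_of_notMem {U : Set E} {p : ℕ} (ω : Form E p) {x : E} (hx : x ∉ U) : cut U ω x = 0 :=
  Set.indicator_of_notMem hx _

theorem cut_cut {U V : Set E} (h : U ⊆ V) {p : ℕ} (ω : Form E p) : cut U (cut V ω) = cut U ω := by
  refine Form.ext fun x => ?_
  by_cases hx : x ∈ U
  · rw [cut_of_mem _ hx, cut_of_mem _ hx, cut_of_mem _ (h hx)]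
  · rw [cut_of_notMem _ hx, cut_of_notMem _ hx]

/-- The space `Ω^p(U)` of holomorphic `p`-forms on the open set `U` (extended by zero).
Holomorphic means complex analytic, that is, locally the sum of a convergent power series. -/
def holForms (U : Set E) (p : ℕ) : Submodule ℂ (Form E p) where
  carrier := {ω | AnalyticOnNhd ℂ (ω : E → E [⋀^Fin p]→L[ℂ] ℂ) U ∧ ∀ x ∉ U, ω x = 0}
  add_mem' := fun {a b} ha hb =>
    ⟨fun x hx => (ha.1 x hx).add (hb.1 x hx), fun x hx => by simp [ha.2 x hx, hb.2 x hx]⟩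
  zero_mem' := ⟨fun _ _ => analyticAt_const, fun _ _ => rfl⟩
  smul_mem' := fun c a ha =>
    ⟨fun x hx => (analyticAt_const (v := c)).smul (ha.1 x hx), fun x hx => by
      rw [Form.smul_apply, ha.2 x hx]; ext v; simp⟩

theorem holForms_analyticAt {U : Set E} {p : ℕ} {ω : Form E p} (h : ω ∈ holForms U p) {x : E}
    (hx : x ∈ U) : AnalyticAt ℂ (ω : E → E [⋀^Fin p]→L[ℂ] ℂ) x := And.left h x hx

theorem holForms_zero {U : Set E} {p : ℕ} {ω : Form E p} (h : ω ∈ holForms U p) {x : E}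
    (hx : x ∉ U) : ω x = 0 := And.right h x hx

/-- The exterior derivative of a form on the open set `U` (extended by zero). -/
noncomputable def dOn (U : Set E) {p : ℕ} (ω : Form E p) : Form E (p + 1) :=
  cut U (extDeriv (ω : E → E [⋀^Fin p]→L[ℂ] ℂ) : E → E [⋀^Fin (p + 1)]→L[ℂ] ℂ)

theorem dOn_of_mem {U : Set E} {p : ℕ} (ω : Form E p) {x : E} (hx : x ∈ U) :
    dOn U ω x = extDeriv (ω : E → E [⋀^Fin p]→L[ℂ] ℂ) x := cut_of_mem _ hx

theorem dOn_of_notMem {U : Set E} {p : ℕ} (ω : Form E p) {x : E} (hx : x ∉ U) :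
    dOn U ω x = 0 := cut_of_notMem _ hx

theorem dOn_add {U : Set E} {p : ℕ} {ω ω' : Form E p} (h : ω ∈ holForms U p)
    (h' : ω' ∈ holForms U p) : dOn U (ω + ω') = dOn U ω + dOn U ω' := by
  refine Form.ext fun x => ?_
  by_cases hx : x ∈ U
  · rw [Form.add_apply, dOn_of_mem _ hx, dOn_of_mem _ hx, dOn_of_mem _ hx]
    exact extDeriv_add (holForms_analyticAt h hx).differentiableAt
      (holForms_analyticAt h' hx).differentiableAt
  · rw [Form.add_apply, dOn_of_notMem _ hx, dOn_of_notMem _ hx, dOn_of_notMem _ hx, add_zero]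

theorem dOn_smul {U : Set E} {p : ℕ} (c : ℂ) (ω : Form E p) :
    dOn U (c • ω) = c • dOn U ω := by
  refine Form.ext fun x => ?_
  by_cases hx : x ∈ U
  · rw [Form.smul_apply, dOn_of_mem _ hx, dOn_of_mem _ hx]
    exact extDeriv_smul c (ω : E → E [⋀^Fin p]→L[ℂ] ℂ)
  · rw [Form.smul_apply, dOn_of_notMem _ hx, dOn_of_notMem _ hx]
    ext v; simp

theorem dOn_congr {U : Set E} (hU : IsOpen U) {p : ℕ} {ω ω' : Form E p}
    (h : ∀ x ∈ U, ω x = ω' x) : dOn U ω = dOn U ω' := by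
  refine Form.ext fun x => ?_
  by_cases hx : x ∈ U
  · rw [dOn_of_mem _ hx, dOn_of_mem _ hx]
    exact (Set.EqOn.eventuallyEq_of_mem (fun y hy => h y hy) (hU.mem_nhds hx)).extDeriv_eq
  · rw [dOn_of_notMem _ hx, dOn_of_notMem _ hx]

theorem dOn_cut {U V : Set E} (hU : IsOpen U) (hUV : U ⊆ V) {p : ℕ} (ω : Form E p) :
    dOn U (cut V ω) = dOn U ω :=
  dOn_congr hU fun _ hx => cut_of_mem _ (hUV hx)

theorem dOn_dOn {U : Set E} (hU : IsOpen U) {p : ℕ} {ω : Form E p} (h : ω ∈ holForms U p) :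
    dOn U (dOn U ω) = 0 := by
  refine (dOn_cut hU subset_rfl _).trans (Form.ext fun x => ?_)
  by_cases hx : x ∈ U
  · refine (dOn_of_mem _ hx).trans ?_
    exact extDeriv_extDeriv_apply ((holForms_analyticAt h hx).contDiffAt (n := ⊤)) le_top
  · exact dOn_of_notMem _ hx

/-- A subcomplex of the complex `Ω^•(U)` of holomorphic forms on the open set `U`. -/
structure Subcomplex (U : Set E) where
  isOpen : IsOpen U
  carrier : ∀ p : ℕ, Submodule ℂ (Form E p)
  le_holForms : ∀ p, carrier p ≤ holForms U p
  dOn_mem : ∀ {p} {ω : Form E p}, ω ∈ carrier p → dOn U ω ∈ carrier (p + 1)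

/-- The restriction `α|_H` (pullback along the inclusion) of a form to a linear subspace `H`. -/
noncomputable def pull (H : Submodule ℂ E) {p : ℕ} : Form E p →ₗ[ℂ] Form H p where
  toFun α := fun x => (α x).compContinuousLinearMap H.subtypeL
  map_add' _ _ := rfl
  map_smul' _ _ := rfl

theorem pull_apply (H : Submodule ℂ E) {p : ℕ} (α : Form E p) (x : H) :
    pull H α x = (α x).compContinuousLinearMap H.subtypeL := rfl

theorem pull_cut (H : Submodule ℂ E) (U : Set E) {p : ℕ} (α : Form E p) :
    pull H (cut U α) = cut (Subtype.val ⁻¹' U) (pull H α) := by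
  refine Form.ext fun x => ?_
  by_cases hx : (x : E) ∈ U
  · have hx' : x ∈ (Subtype.val ⁻¹' U : Set H) := hx
    rw [pull_apply, cut_of_mem _ hx, cut_of_mem _ hx', pull_apply]
  · have hx' : x ∉ (Subtype.val ⁻¹' U : Set H) := hx
    rw [pull_apply, cut_of_notMem _ hx, cut_of_notMem _ hx']
    ext v; simp

theorem pull_dOn (H : Submodule ℂ E) {U : Set E} {p : ℕ} {α : Form E p} (hα : α ∈ holForms U p) :
    pull H (dOn U α) = dOn (Subtype.val ⁻¹' U) (pull H α) := by
  refine Form.ext fun x => ?_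
  by_cases hx : (x : E) ∈ U
  · have hx' : x ∈ (Subtype.val ⁻¹' U : Set H) := hx
    rw [pull_apply, dOn_of_mem _ hx, dOn_of_mem _ hx']
    have := extDeriv_pullback (ω := (α : E → E [⋀^Fin p]→L[ℂ] ℂ)) (f := H.subtypeL) (x := x) (r := ⊤)
      (holForms_analyticAt hα hx).differentiableAt H.subtypeL.contDiff.contDiffAt le_top
    simp only [ContinuousLinearMap.fderiv] at this
    exact this.symm
  · have hx' : x ∉ (Subtype.val ⁻¹' U : Set H) := hx
    rw [pull_apply, dOn_of_notMem _ hx, dOn_of_notMem _ hx']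
    ext v; simp

end Forms2

/-! ### Central hyperplane arrangements -/

/-- A central hyperplane arrangement: a finite set of linear hyperplanes of `E`, that is, of
maximal proper linear subspaces. -/
structure CentralArrangement (E : Type u) [NormedAddCommGroup E] [NormedSpace ℂ E] where
  hyperplanes : Set (Submodule ℂ E)
  finite : hyperplanes.Finite
  isCoatom : ∀ X ∈ hyperplanes, IsCoatom X

section Arr

variable {E : Type u} [NormedAddCommGroup E] [NormedSpace ℂ E]

open Classical in
/-- The logarithmic `1`-form `ω_X = df / f` of a hyperplane `X = {f = 0}`, extended by zero on `X`.
It does not depend on the equation `f` of `X`, see `logForm_eq`. -/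
noncomputable def logForm (X : Submodule ℂ E) : E → E →L[ℂ] ℂ :=
  if h : ∃ f : E →L[ℂ] ℂ, LinearMap.ker f.toLinearMap = X then
    fun x => (h.choose x)⁻¹ • h.choose
  else 0

theorem logForm_eq {X : Submodule ℂ E} {f : E →L[ℂ] ℂ} (hf : LinearMap.ker f.toLinearMap = X) (x : E) :
    logForm X x = (f x)⁻¹ • f := by
  have h : ∃ f : E →L[ℂ] ℂ, LinearMap.ker f.toLinearMap = X := ⟨f, hf⟩
  rw [logForm, dif_pos h]
  set g := h.choose
  have hg : LinearMap.ker g.toLinearMap = X := h.choose_spec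
  have key : ∀ y, f y = 0 ↔ g y = 0 := fun y => by
    have := (SetLike.ext_iff.mp (hf.trans hg.symm)) y
    simpa using this
  by_cases hx : f x = 0
  · rw [hx, (key x).1 hx]; ext v; simp
  · have hgx : g x ≠ 0 := fun h => hx ((key x).2 h)
    ext v
    have : g (v - (f v / f x) • x) = 0 := (key _).1 (by simp [hx])
    simp only [map_sub, map_smul, smul_eq_mul, sub_eq_zero] at this
    simp only [_root_.smul_apply, smul_eq_mul, this]
    field_simp

theorem exists_form [FiniteDimensional ℂ E] {X : Submodule ℂ E} (hX : IsCoatom X) :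
    ∃ f : E →L[ℂ] ℂ, LinearMap.ker f.toLinearMap = X := by
  obtain ⟨v, hv⟩ : ∃ v, v ∉ X := by
    by_contra! h
    exact hX.1 (eq_top_iff.mpr fun x _ => h x)
  obtain ⟨f, hf, hfX⟩ := Submodule.exists_le_ker_of_notMem (p := X) hv
  refine ⟨f.toContinuousLinearMap, ?_⟩
  have hle : X ≤ LinearMap.ker f := hfX
  rcases hX.le_iff.mp hle with h | h
  · exact absurd (h ▸ Submodule.mem_top : v ∈ LinearMap.ker f) (by simpa using hf)
  · simpa using h

namespace CentralArrangement

/-- The complement of the union of the hyperplanes. -/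
def complement (A : CentralArrangement E) : Set E := {x | ∀ X ∈ A.hyperplanes, x ∉ X}

theorem isOpen_complement [FiniteDimensional ℂ E] (A : CentralArrangement E) :
    IsOpen A.complement := by
  have : A.complement = ⋂ X ∈ A.hyperplanes, (X : Set E)ᶜ := by ext; simp [complement]
  rw [this]
  exact A.finite.isOpen_biInter fun X _ => (Submodule.closed_of_finiteDimensional X).isOpen_compl

/-- The deletion of `A` with respect to `H`: the hyperplanes of `A` other than `H`. -/
def deletion (A : CentralArrangement E) (H : Submodule ℂ E) : CentralArrangement E where
  hyperplanes := A.hyperplanes \ {H}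
  finite := A.finite.subset Set.sdiff_subset
  isCoatom := fun X hX => A.isCoatom X hX.1

theorem isCoatom_comap {H X : Submodule ℂ E} (hH : IsCoatom H) (hX : IsCoatom X) (h : X ≠ H) :
    IsCoatom (X.comap H.subtype) := by
  refine (Submodule.isCoatom_comap_or_eq_top H.subtype hX).resolve_right fun htop => ?_
  rcases hH.le_iff.mp (Submodule.comap_subtype_eq_top.mp htop) with h' | h'
  · exact hX.1 h'
  · exact h h'

/-- The restriction of `A` with respect to its member `H`: the arrangement on `H` of all the
intersections `H ∩ X`, for `X` in `A` other than `H`. -/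
def restriction (A : CentralArrangement E) {H : Submodule ℂ E} (hH : H ∈ A.hyperplanes) :
    CentralArrangement H where
  hyperplanes := (fun X : Submodule ℂ E => X.comap H.subtype) '' (A.hyperplanes \ {H})
  finite := (A.finite.subset Set.sdiff_subset).image _
  isCoatom := by
    rintro _ ⟨X, hX, rfl⟩
    exact isCoatom_comap (A.isCoatom H hH) (A.isCoatom X hX.1) hX.2

theorem complement_restriction (A : CentralArrangement E) {H : Submodule ℂ E}
    (hH : H ∈ A.hyperplanes) :
    (A.restriction hH).complement = Subtype.val ⁻¹' (A.deletion H).complement := by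
  ext x
  constructor
  · intro h X hX hx
    exact h _ ⟨X, hX, rfl⟩ hx
  · rintro h _ ⟨X, hX, rfl⟩ hx
    exact h X hX hx

theorem complement_subset_deletion (A : CentralArrangement E) (H : Submodule ℂ E) :
    A.complement ⊆ (A.deletion H).complement := fun _ hx X hX => hx X hX.1

end CentralArrangement
end Arr

namespace CentralArrangement
section C

open ContinuousAlternatingMap
variable {E : Type u} [NormedAddCommGroup E] [NormedSpace ℂ E]

/-- The linear map `ω ↦ ω ∧ ω_X`. -/
noncomputable def wedgeLog (X : Submodule ℂ E) {p : ℕ} : Form E p →ₗ[ℂ] Form E (p + 1) where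
  toFun ω := fun x => wedge (ω x) (logForm X x)
  map_add' _ _ := funext fun _ => wedge_add _ _ _
  map_smul' _ _ := funext fun _ => wedge_smul _ _ _

theorem wedgeLog_apply (X : Submodule ℂ E) {p : ℕ} (ω : Form E p) (x : E) :
    wedgeLog X ω x = wedge (ω x) (logForm X x) := rfl

/-- `A.IsLogMonomial I p ω` says that `ω` is the `p`-form `η ∧ ω_{X₁} ∧ ⋯ ∧ ω_{X_k}` on the complement
of `A`, where `η` is a holomorphic form on all of `E` and `X₁, …, X_k` are the distinct elements, in
some order, of the subset `I` of `A`. Another order changes this form by a sign only. -/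
inductive IsLogMonomial (A : CentralArrangement E) :
    Finset (Submodule ℂ E) → (p : ℕ) → Form E p → Prop
  | holomorphic {p : ℕ} (η : Form E p) (hη : η ∈ holForms Set.univ p) :
      IsLogMonomial A ∅ p (cut A.complement η)
  | wedge {I : Finset (Submodule ℂ E)} {p : ℕ} {ω : Form E p} {X : Submodule ℂ E}
      (hX : X ∈ A.hyperplanes) (hXI : X ∉ I) (h : IsLogMonomial A I p ω) :
      IsLogMonomial A (I.cons X hXI) (p + 1) (wedgeLog X ω)

/-- The space `Ω^p⟨A⟩` of `p`-forms with logarithmic poles along `A`: the linear combinations of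
forms `η ∧ ω_I`, with `η` holomorphic on `E` and `I` a subset of `A`, as forms on the complement. -/
noncomputable def logForms (A : CentralArrangement E) (p : ℕ) : Submodule ℂ (Form E p) :=
  Submodule.span ℂ {ω | ∃ I, A.IsLogMonomial I p ω}

/-- The weight filtration `W_k Ω^p⟨A⟩`: the linear combinations of forms `η ∧ ω_I` with `η`
holomorphic on `E` and `|I| ≤ k`. It is zero for `k < 0`. -/
noncomputable def weight (A : CentralArrangement E) (k : ℤ) (p : ℕ) : Submodule ℂ (Form E p) :=
  Submodule.span ℂ {ω | ∃ I : Finset (Submodule ℂ E), (I.card : ℤ) ≤ k ∧ A.IsLogMonomial I p ω}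

theorem weight_mono (A : CentralArrangement E) {k l : ℤ} (h : k ≤ l) (p : ℕ) :
    A.weight k p ≤ A.weight l p :=
  Submodule.span_mono fun _ ⟨I, hI, hω⟩ => ⟨I, hI.trans h, hω⟩

theorem weight_le_logForms (A : CentralArrangement E) (k : ℤ) (p : ℕ) :
    A.weight k p ≤ A.logForms p :=
  Submodule.span_mono fun _ ⟨I, _, hω⟩ => ⟨I, hω⟩

theorem exists_mem_weight {A : CentralArrangement E} {p : ℕ} {ω : Form E p}
    (h : ω ∈ A.logForms p) : ∃ k, ω ∈ A.weight k p := by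
  induction h using Submodule.span_induction with
  | mem ω h => obtain ⟨I, hI⟩ := h; exact ⟨I.card, Submodule.subset_span ⟨I, le_rfl, hI⟩⟩
  | zero => exact ⟨0, zero_mem _⟩
  | add a b _ _ ha hb =>
    obtain ⟨k, hk⟩ := ha
    obtain ⟨l, hl⟩ := hb
    exact ⟨max k l, add_mem (A.weight_mono (le_max_left _ _) _ hk)
      (A.weight_mono (le_max_right _ _) _ hl)⟩
  | smul c a _ ha => obtain ⟨k, hk⟩ := ha; exact ⟨k, Submodule.smul_mem _ _ hk⟩

theorem wedgeLog_cut (U : Set E) (X : Submodule ℂ E) {p : ℕ} (ω : Form E p) :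
    wedgeLog X (cut U ω) = cut U (wedgeLog X ω) := by
  refine Form.ext fun x => ?_
  rw [wedgeLog_apply]
  by_cases hx : x ∈ U
  · rw [cut_of_mem _ hx, cut_of_mem _ hx, wedgeLog_apply]
  · rw [cut_of_notMem _ hx, cut_of_notMem _ hx, wedge_zero_left]

theorem IsLogMonomial.mem_weight {A : CentralArrangement E} {I : Finset (Submodule ℂ E)} {p : ℕ}
    {ω : Form E p} (h : A.IsLogMonomial I p ω) {k : ℤ} (hk : (I.card : ℤ) ≤ k) :
    ω ∈ A.weight k p := Submodule.subset_span ⟨I, hk, h⟩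

theorem weight_induction {A : CentralArrangement E} {k : ℤ} {p : ℕ} {M : Submodule ℂ (Form E p)}
    (h : ∀ (I : Finset (Submodule ℂ E)) (ω : Form E p), (I.card : ℤ) ≤ k →
      A.IsLogMonomial I p ω → ω ∈ M) : A.weight k p ≤ M :=
  Submodule.span_le.mpr fun ω ⟨I, hI, hω⟩ => h I ω hI hω

theorem IsLogMonomial.wedge_eq_zero {A : CentralArrangement E} {I : Finset (Submodule ℂ E)} {p : ℕ}
    {ω : Form E p} (h : A.IsLogMonomial I p ω) {X : Submodule ℂ E} (hX : X ∈ I) :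
    wedgeLog X ω = 0 := by
  induction h with
  | holomorphic => simp at hX
  | @wedge I p ω Y hY hYI h ih =>
    refine Form.ext fun x => ?_
    rw [wedgeLog_apply, wedgeLog_apply, Form.zero_apply]
    rcases Finset.mem_cons.mp hX with rfl | hX
    · exact wedge_wedge_self _ _
    · have h1 : LogForms.wedge (ω x) (logForm X x) = 0 := congrFun (ih hX) x
      rw [wedge_wedge_comm, h1, wedge_zero_left, neg_zero]

theorem wedgeLog_mem_weight {A : CentralArrangement E} {X : Submodule ℂ E}
    (hX : X ∈ A.hyperplanes) {k : ℤ} {p : ℕ} {ω : Form E p} (h : ω ∈ A.weight k p) :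
    wedgeLog X ω ∈ A.weight (k + 1) (p + 1) := by
  revert ω
  change A.weight k p ≤ (A.weight (k + 1) (p + 1)).comap (wedgeLog X)
  refine weight_induction fun I ω hI hω => ?_
  by_cases hXI : X ∈ I
  · rw [Submodule.mem_comap, hω.wedge_eq_zero hXI]; exact zero_mem _
  · exact (IsLogMonomial.wedge hX hXI hω).mem_weight (by rw [Finset.card_cons]; push_cast; omega)

variable [FiniteDimensional ℂ E]

theorem analyticAt_logForm {X : Submodule ℂ E} (hX : IsCoatom X) {x : E} (hx : x ∉ X) :
    AnalyticAt ℂ (logForm X) x := by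
  obtain ⟨f, rfl⟩ := exists_form hX
  have : logForm (LinearMap.ker f.toLinearMap) = fun y => (f y)⁻¹ • f := funext (logForm_eq rfl)
  rw [this]
  exact ((f.analyticAt x).inv (by simpa using hx)).smul analyticAt_const

theorem cut_mem_holForms {U V : Set E} (hU : IsOpen U) (hUV : U ⊆ V) {p : ℕ} {ω : Form E p}
    (h : ω ∈ holForms V p) : cut U ω ∈ holForms U p := by
  refine ⟨fun x hx => ?_, fun x hx => cut_of_notMem _ hx⟩
  refine (holForms_analyticAt h (hUV hx)).congr ?_
  filter_upwards [hU.mem_nhds hx] with y hy using (cut_of_mem _ hy).symm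

theorem wedgeLog_mem_holForms {U : Set E} {X : Submodule ℂ E} (hX : IsCoatom X)
    (hXU : ∀ x ∈ U, x ∉ X) {p : ℕ} {ω : Form E p} (h : ω ∈ holForms U p) :
    wedgeLog X ω ∈ holForms U (p + 1) := by
  refine ⟨fun x hx => ?_, fun x hx => ?_⟩
  · exact analyticAt_wedge (holForms_analyticAt h hx) (analyticAt_logForm hX (hXU x hx))
  · rw [wedgeLog_apply, holForms_zero h hx, wedge_zero_left]

theorem IsLogMonomial.mem_holForms {A : CentralArrangement E} {I : Finset (Submodule ℂ E)} {p : ℕ}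
    {ω : Form E p} (h : A.IsLogMonomial I p ω) : ω ∈ holForms A.complement p := by
  induction h with
  | holomorphic η hη => exact cut_mem_holForms A.isOpen_complement (Set.subset_univ _) hη
  | wedge hX hXI h ih => exact wedgeLog_mem_holForms (U := A.complement) (A.isCoatom _ hX) (fun x hx => hx _ hX) ih

theorem logForms_le_holForms (A : CentralArrangement E) (p : ℕ) :
    A.logForms p ≤ holForms A.complement p :=
  Submodule.span_le.mpr fun _ ⟨_, hω⟩ => hω.mem_holForms

theorem weight_le_holForms (A : CentralArrangement E) (k : ℤ) (p : ℕ) :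
    A.weight k p ≤ holForms A.complement p :=
  (A.weight_le_logForms k p).trans (A.logForms_le_holForms p)

theorem dOn_wedgeLog {U : Set E} {X : Submodule ℂ E} (hX : IsCoatom X)
    (hXU : ∀ x ∈ U, x ∉ X) {p : ℕ} {ω : Form E p}
    (hω : ∀ x ∈ U, DifferentiableAt ℂ (ω : E → E [⋀^Fin p]→L[ℂ] ℂ) x) :
    dOn U (wedgeLog X ω) = wedgeLog X (dOn U ω) := by
  obtain ⟨f, rfl⟩ := exists_form hX
  refine Form.ext fun x => ?_
  rw [wedgeLog_apply]
  by_cases hx : x ∈ U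
  · rw [dOn_of_mem _ hx, dOn_of_mem _ hx, logForm_eq rfl]
    have e : wedgeLog (LinearMap.ker f.toLinearMap) ω = fun y => wedge (ω y) ((f y)⁻¹ • f) :=
      funext fun y => by rw [← logForm_eq rfl]; rfl
    rw [e]
    exact extDeriv_wedge_dlog f (hω x hx) (by simpa using hXU x hx)
  · rw [dOn_of_notMem _ hx, dOn_of_notMem _ hx, wedge_zero_left]

theorem dOn_mem_holForms {U : Set E} (hU : IsOpen U) {p : ℕ} {ω : Form E p}
    (h : ω ∈ holForms U p) : dOn U ω ∈ holForms U (p + 1) := by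
  refine ⟨fun x hx => ?_, fun x hx => dOn_of_notMem _ hx⟩
  refine (analyticAt_extDeriv (holForms_analyticAt h hx)).congr ?_
  filter_upwards [hU.mem_nhds hx] with y hy using (dOn_of_mem _ hy).symm

theorem IsLogMonomial.dOn {A : CentralArrangement E} {I : Finset (Submodule ℂ E)} {p : ℕ}
    {ω : Form E p} (h : A.IsLogMonomial I p ω) :
    A.IsLogMonomial I (p + 1) (LogForms.dOn A.complement ω) := by
  induction h with
  | holomorphic η hη =>
    have e : LogForms.dOn A.complement (cut A.complement η) =
        cut A.complement (LogForms.dOn Set.univ η) := by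
      rw [dOn_cut A.isOpen_complement subset_rfl]
      exact (cut_cut (Set.subset_univ _) _).symm
    rw [e]
    exact .holomorphic _ (dOn_mem_holForms isOpen_univ hη)
  | @wedge I p ω X hX hXI h ih =>
    rw [dOn_wedgeLog (U := A.complement) (A.isCoatom X hX) (fun x hx => hx X hX)
      fun x hx => (holForms_analyticAt h.mem_holForms hx).differentiableAt]
    exact .wedge hX hXI ih

theorem dOn_mem_weight {A : CentralArrangement E} {k : ℤ} {p : ℕ} {ω : Form E p}
    (h : ω ∈ A.weight k p) : LogForms.dOn A.complement ω ∈ A.weight k (p + 1) := by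
  induction h using Submodule.span_induction with
  | mem ω h => obtain ⟨I, hI, hω⟩ := h; exact hω.dOn.mem_weight hI
  | zero =>
    have := dOn_smul (U := A.complement) (0 : ℂ) (0 : Form E p)
    rw [zero_smul, zero_smul] at this
    rw [this]; exact zero_mem _
  | add a b ha hb iha ihb =>
    rw [dOn_add (A.weight_le_holForms k p ha) (A.weight_le_holForms k p hb)]
    exact add_mem iha ihb
  | smul c a _ ih => rw [dOn_smul]; exact Submodule.smul_mem _ _ ih

theorem dOn_mem_logForms {A : CentralArrangement E} {p : ℕ} {ω : Form E p}
    (h : ω ∈ A.logForms p) : LogForms.dOn A.complement ω ∈ A.logForms (p + 1) := by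
  obtain ⟨k, hk⟩ := exists_mem_weight h
  exact A.weight_le_logForms k _ (dOn_mem_weight hk)

theorem cut_mem_weight {A : CentralArrangement E} (H : Submodule ℂ E) {k : ℤ} {p : ℕ}
    {ω : Form E p} (h : ω ∈ (A.deletion H).weight k p) :
    cut A.complement ω ∈ A.weight k p := by
  revert ω
  change (A.deletion H).weight k p ≤ (A.weight k p).comap (cut A.complement)
  refine weight_induction fun I ω hI hω => ?_
  suffices h : A.IsLogMonomial I p (cut A.complement ω) from h.mem_weight hI
  clear hI
  induction hω with
  | holomorphic η hη =>
    rw [cut_cut (A.complement_subset_deletion H)]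
    exact .holomorphic η hη
  | @wedge I p ω X hX hXI h ih =>
    rw [← wedgeLog_cut]
    exact .wedge hX.1 hXI ih

theorem cut_mem_logForms {A : CentralArrangement E} (H : Submodule ℂ E) {p : ℕ}
    {ω : Form E p} (h : ω ∈ (A.deletion H).logForms p) :
    cut A.complement ω ∈ A.logForms p := by
  obtain ⟨k, hk⟩ := exists_mem_weight h
  exact A.weight_le_logForms k _ (cut_mem_weight H hk)

/-- The forms `α ∧ ω_H` with `α` of weight at most `k - 1` and logarithmic along the deletion. -/
noncomputable def polarPart (A : CentralArrangement E) (H : Submodule ℂ E) (k : ℤ) :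
    ∀ p : ℕ, Submodule ℂ (Form E p)
  | 0 => ⊥
  | p + 1 => ((A.deletion H).weight (k - 1) p).map (wedgeLog H)

theorem polarPart_wedge {A : CentralArrangement E} {H X : Submodule ℂ E} (hX : X ∈ A.hyperplanes)
    {k : ℤ} {p : ℕ} {ω : Form E p} (h : ω ∈ A.polarPart H k p) :
    wedgeLog X ω ∈ A.polarPart H (k + 1) (p + 1) := by
  cases p with
  | zero =>
    rw [(Submodule.mem_bot ℂ).mp h, _root_.map_zero]; exact zero_mem _
  | succ p =>
    obtain ⟨α, hα, rfl⟩ := h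
    by_cases hXH : X = H
    · subst hXH
      have : wedgeLog X (wedgeLog X α) = 0 := funext fun x => wedge_wedge_self _ _
      rw [this]; exact zero_mem _
    · have : wedgeLog X (wedgeLog H α) = wedgeLog H (wedgeLog X (-α)) := by
        rw [map_neg, map_neg]
        exact funext fun x => wedge_wedge_comm _ _ _
      rw [this]
      refine ⟨_, ?_, rfl⟩
      have h1 := wedgeLog_mem_weight (A := A.deletion H) (X := X) ⟨hX, hXH⟩ (neg_mem hα)
      rwa [show k + 1 - 1 = k - 1 + 1 by ring]

theorem logForm_of_mem {X : Submodule ℂ E} (hX : IsCoatom X) {x : E} (hx : x ∈ X) :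
    logForm X x = 0 := by
  obtain ⟨f, rfl⟩ := exists_form hX
  rw [logForm_eq rfl, show f x = 0 by simpa using hx]; ext; simp

theorem mem_complement_of_deletion {A : CentralArrangement E} {H : Submodule ℂ E} {x : E}
    (hx : x ∈ (A.deletion H).complement) (hxH : x ∉ H) : x ∈ A.complement := by
  intro X hX
  by_cases h : X = H
  · rwa [h]
  · exact hx X ⟨hX, h⟩

theorem IsLogMonomial.decomp {A : CentralArrangement E} {H : Submodule ℂ E}
    (hH : H ∈ A.hyperplanes) {I : Finset (Submodule ℂ E)} {p : ℕ}
    {ω : Form E p} (h : A.IsLogMonomial I p ω) :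
    ω ∈ A.polarPart H I.card p ⊔
      ((A.deletion H).weight I.card p).map (cut A.complement) := by
  induction h with
  | holomorphic η hη =>
    exact Submodule.mem_sup_right ⟨cut (A.deletion H).complement η,
      (IsLogMonomial.holomorphic η hη).mem_weight (by simp),
      cut_cut (A.complement_subset_deletion H) η⟩
  | @wedge I p ω X hX hXI h ih =>
    obtain ⟨γ, hγ, _, ⟨β, hβ, rfl⟩, rfl⟩ := Submodule.mem_sup.mp ih
    rw [map_add, Finset.card_cons, Nat.cast_succ]
    refine add_mem (Submodule.mem_sup_left (polarPart_wedge hX hγ)) ?_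
    by_cases hXH : X = H
    · subst hXH
      refine Submodule.mem_sup_left ⟨β, by simpa using hβ, ?_⟩
      refine Form.ext fun x => ?_
      rw [wedgeLog_apply, wedgeLog_apply]
      by_cases hxX : x ∈ X
      · rw [logForm_of_mem (A.isCoatom X hX) hxX, wedge_zero_right, wedge_zero_right]
      · by_cases hx : x ∈ A.complement
        · rw [cut_of_mem _ hx]
        · rw [cut_of_notMem _ hx, holForms_zero (weight_le_holForms _ _ _ hβ)
            fun hx' => hx (mem_complement_of_deletion hx' hxX)]
    · refine Submodule.mem_sup_right ⟨wedgeLog X β, ?_, (wedgeLog_cut _ _ _).symm⟩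
      exact wedgeLog_mem_weight (A := A.deletion H) ⟨hX, hXH⟩ hβ

theorem polarPart_mono (A : CentralArrangement E) (H : Submodule ℂ E) {k l : ℤ} (h : k ≤ l)
    (p : ℕ) : A.polarPart H k p ≤ A.polarPart H l p := by
  cases p with
  | zero => exact le_rfl
  | succ p => exact Submodule.map_mono (weight_mono _ (by omega) _)

theorem weight_decomp {A : CentralArrangement E} {H : Submodule ℂ E} (hH : H ∈ A.hyperplanes)
    (k : ℤ) (p : ℕ) : A.weight k p ≤ A.polarPart H k p ⊔
      ((A.deletion H).weight k p).map (cut A.complement) :=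
  weight_induction fun _ _ hI hω => sup_le_sup (A.polarPart_mono H hI p)
    (Submodule.map_mono (weight_mono _ hI p)) (hω.decomp hH)

theorem weight_decomp_zero {A : CentralArrangement E} {H : Submodule ℂ E} (hH : H ∈ A.hyperplanes)
    {k : ℤ} {ω : Form E 0} (h : ω ∈ A.weight k 0) :
    ∃ β ∈ (A.deletion H).weight k 0, ω = cut A.complement β := by
  obtain ⟨γ, hγ, _, ⟨β, hβ, rfl⟩, rfl⟩ := Submodule.mem_sup.mp (weight_decomp hH k 0 h)
  refine ⟨β, hβ, ?_⟩
  rw [(Submodule.mem_bot ℂ).mp hγ, zero_add]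

theorem weight_decomp_succ {A : CentralArrangement E} {H : Submodule ℂ E} (hH : H ∈ A.hyperplanes)
    {k : ℤ} {p : ℕ} {ω : Form E (p + 1)} (h : ω ∈ A.weight k (p + 1)) :
    ∃ α ∈ (A.deletion H).weight (k - 1) p, ∃ β ∈ (A.deletion H).weight k (p + 1),
      ω = wedgeLog H α + cut A.complement β := by
  obtain ⟨_, ⟨α, hα, rfl⟩, _, ⟨β, hβ, rfl⟩, rfl⟩ :=
    Submodule.mem_sup.mp (weight_decomp hH k (p + 1) h)
  exact ⟨α, hα, β, hβ, rfl⟩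

theorem pull_eq_zero_of_wedge {H : Submodule ℂ E} {f : E →L[ℂ] ℂ}
    (hf : LinearMap.ker f.toLinearMap = H) (hH : H ≠ ⊤)
    {p : ℕ} {α : E [⋀^Fin p]→L[ℂ] ℂ} (h : wedge α f = 0) :
    α.compContinuousLinearMap H.subtypeL = 0 := by
  obtain ⟨v₀, hv₀⟩ : ∃ v, v ∉ H := by
    by_contra! h; exact hH (eq_top_iff.mpr fun x _ => h x)
  have hfv : f v₀ ≠ 0 := fun h0 => hv₀ (hf ▸ (by simpa using h0))
  have hfH : ∀ v : H, f v = 0 := fun v => by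
    have : (v : E) ∈ LinearMap.ker f.toLinearMap := hf ▸ v.2
    simpa using this
  ext v
  have := congrArg (fun ω => ω (Fin.cons v₀ fun i => (v i : E))) h
  simp only [wedge_apply, Fin.sum_univ_succ, Fin.cons_succ, hfH, Fin.cons_zero, mul_zero,
    Finset.sum_const_zero, add_zero] at this
  change _ = (0 : ℂ) at this
  have h2 := (mul_eq_zero.mp this).resolve_left (pow_ne_zero _ (by norm_num))
  have h3 := (mul_eq_zero.mp h2).resolve_right hfv
  rw [Fin.removeNth_zero, Fin.tail_cons] at h3
  exact h3

theorem pull_unique {A : CentralArrangement E} {H : Submodule ℂ E} (hH : H ∈ A.hyperplanes)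
    {p : ℕ} {α : Form E p} {β : Form E (p + 1)} (hα : α ∈ holForms (A.deletion H).complement p)
    (hβ : β ∈ holForms (A.deletion H).complement (p + 1))
    (h : wedgeLog H α + cut A.complement β = 0) : pull H α = 0 := by
  obtain ⟨f, hf⟩ := exists_form (A.isCoatom H hH)
  have hker : ∀ y, f y = 0 ↔ y ∈ H := fun y => by rw [← hf]; simp
  funext x
  by_cases hx : (x : E) ∈ (A.deletion H).complement
  · refine pull_eq_zero_of_wedge hf (A.isCoatom H hH).1 ?_
    have hc : ContinuousAt (fun y => wedge (α y) f + f y • β y) (x : E) :=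
      ((analyticAt_wedge (holForms_analyticAt hα hx) analyticAt_const).add
        ((f.analyticAt _).smul (holForms_analyticAt hβ hx))).continuousAt
    have hd : Dense ((H : Set E)ᶜ) := by
      rw [← interior_eq_empty_iff_dense_compl]
      by_contra hne
      exact (A.isCoatom H hH).1
        (Submodule.eq_top_of_nonempty_interior' H (Set.nonempty_iff_ne_empty.mpr hne))
    have hz : ∀ y ∈ (A.deletion H).complement ∩ (H : Set E)ᶜ, wedge (α y) f + f y • β y = 0 := by
      rintro y ⟨hy, hyH⟩
      have h1 := congrFun h y
      rw [Form.add_apply, wedgeLog_apply, Form.zero_apply, cut_of_mem _ (mem_complement_of_deletion hy hyH), logForm_eq hf,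
        wedge_smul_right] at h1
      have hfy : f y ≠ 0 := fun h0 => hyH ((hker y).1 h0)
      have h2 := congrArg (fun w => f y • w) h1
      ext v
      have h3 := congrArg (fun ω => ω v) h2
      simp only [ContinuousAlternatingMap.smul_apply, ContinuousAlternatingMap.add_apply,
        smul_eq_mul] at h3 ⊢
      change _ = f y * (0 : ℂ) at h3
      change _ = (0 : ℂ)
      rw [← mul_zero (f y), ← h3]; field_simp
    have hcl : (x : E) ∈ closure ((A.deletion H).complement ∩ (H : Set E)ᶜ) :=
      (hd.open_subset_closure_inter (A.deletion H).isOpen_complement) hx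
    have h0 : wedge (α x) f + f x • β x = 0 := by
      have := hcl
      have hmem := hc.continuousWithinAt.mem_closure
        (s := (A.deletion H).complement ∩ (H : Set E)ᶜ) hcl
        (t := {0}) (fun y hy => hz y hy)
      simpa using hmem
    rw [(hker x).2 x.2] at h0
    rw [← h0]; ext v; simp
  · change (α x).compContinuousLinearMap _ = 0
    rw [holForms_zero hα hx]; ext v; simp

theorem pull_wedgeLog {H X : Submodule ℂ E} (hX : IsCoatom X) {p : ℕ} (α : Form E p) :
    pull H (wedgeLog X α) = wedgeLog (X.comap H.subtype) (pull H α) := by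
  obtain ⟨f, hf⟩ := exists_form hX
  have hf' : LinearMap.ker (f ∘L H.subtypeL).toLinearMap = X.comap H.subtype := by
    rw [← hf]; rfl
  funext x
  change (wedge (α x) (logForm X x)).compContinuousLinearMap H.subtypeL =
    wedge ((α x).compContinuousLinearMap H.subtypeL) (logForm (X.comap H.subtype) x)
  rw [wedge_comp, logForm_eq hf, logForm_eq hf']
  rfl

theorem pull_mem_weight {A : CentralArrangement E} {H : Submodule ℂ E} (hH : H ∈ A.hyperplanes)
    {k : ℤ} {p : ℕ} {α : Form E p} (h : α ∈ (A.deletion H).weight k p) :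
    pull H α ∈ (A.restriction hH).weight k p := by
  revert α
  change (A.deletion H).weight k p ≤ ((A.restriction hH).weight k p).comap (pull H)
  refine weight_induction fun I ω hI hω => weight_mono _ hI _ ?_
  clear hI
  induction hω with
  | holomorphic η hη =>
    rw [pull_cut, ← complement_restriction A hH]
    refine (IsLogMonomial.holomorphic _ ⟨fun x _ => ?_, fun x hx => absurd trivial hx⟩).mem_weight
      (by simp)
    exact AnalyticAt.comp (g := (compContinuousLinearMapCLM H.subtypeL :
      (E [⋀^Fin _]→L[ℂ] ℂ) →L[ℂ] (H [⋀^Fin _]→L[ℂ] ℂ))) (ContinuousLinearMap.analyticAt _ _)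
      (AnalyticAt.comp (g := (η : E → E [⋀^Fin _]→L[ℂ] ℂ)) (hη.1 _ trivial)
        (H.subtypeL.analyticAt x))
  | @wedge I p ω X hX hXI h ih =>
    rw [pull_wedgeLog ((A.deletion H).isCoatom X hX), Finset.card_cons, Nat.cast_succ]
    exact wedgeLog_mem_weight (A := A.restriction hH) ⟨X, hX, rfl⟩ ih

end C
end CentralArrangement

/-! ### Complexes -/

section Cx
variable {E : Type u} [NormedAddCommGroup E] [NormedSpace ℂ E]

namespace Subcomplex

variable {U : Set E}

/-- The exterior derivative as the differential of a subcomplex. -/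
noncomputable def d (M : Subcomplex U) (p : ℕ) : M.carrier p →ₗ[ℂ] M.carrier (p + 1) where
  toFun ω := ⟨dOn U ω.1, M.dOn_mem ω.2⟩
  map_add' a b := Subtype.ext (dOn_add (M.le_holForms p a.2) (M.le_holForms p b.2))
  map_smul' c a := Subtype.ext (dOn_smul c a.1)

theorem d_d (M : Subcomplex U) (p : ℕ) (ω : M.carrier p) : M.d (p + 1) (M.d p ω) = 0 :=
  Subtype.ext (dOn_dOn M.isOpen (M.le_holForms p ω.2))

/-- A subcomplex of `Ω^•(U)` as a cochain complex of complex vector spaces. -/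
noncomputable def toComplex (M : Subcomplex U) : CochainComplex (ModuleCat.{u} ℂ) ℕ :=
  CochainComplex.of (fun p => ModuleCat.of ℂ (M.carrier p)) (fun p => ModuleCat.ofHom (M.d p))
    fun p => ModuleCat.hom_ext (LinearMap.ext fun ω => M.d_d p ω)

theorem toComplex_d (M : Subcomplex U) (p : ℕ) :
    M.toComplex.d p (p + 1) = ModuleCat.ofHom (M.d p) :=
  CochainComplex.of_d (fun p => ModuleCat.of ℂ (M.carrier p)) (fun p => ModuleCat.ofHom (M.d p)) p

end Subcomplex

section Quotient

variable {C D C' D' : CochainComplex (ModuleCat.{u} ℂ) ℕ}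

theorem range_le_comap_d (f : C ⟶ D) (p q : ℕ) :
    LinearMap.range (f.f p).hom ≤ (LinearMap.range (f.f q).hom).comap (D.d p q).hom := by
  rintro _ ⟨x, rfl⟩
  exact ⟨(C.d p q).hom x, congrArg (fun g => g.hom x) (f.comm p q).symm⟩

/-- The quotient complex `D / f(C)`. -/
noncomputable def quotientComplex (f : C ⟶ D) : CochainComplex (ModuleCat.{u} ℂ) ℕ where
  X p := ModuleCat.of ℂ (D.X p ⧸ LinearMap.range (f.f p).hom)
  d p q := ModuleCat.ofHom (Submodule.mapQ _ _ (D.d p q).hom (range_le_comap_d f p q))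
  shape p q h := by
    refine ModuleCat.hom_ext (Submodule.linearMap_qext _ (LinearMap.ext fun x => ?_))
    change Submodule.Quotient.mk ((D.d p q).hom x) = _
    rw [D.shape p q h]; rfl
  d_comp_d' p q r _ _ := by
    refine ModuleCat.hom_ext (Submodule.linearMap_qext _ (LinearMap.ext fun x => ?_))
    change Submodule.Quotient.mk ((D.d p q ≫ D.d q r).hom x) = _
    rw [D.d_comp_d p q r]; rfl

theorem range_le_comap_map {f : C ⟶ D} {f' : C' ⟶ D'} (a : C ⟶ C') (b : D ⟶ D')
    (h : f ≫ b = a ≫ f') (p : ℕ) :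
    LinearMap.range (f.f p).hom ≤ (LinearMap.range (f'.f p).hom).comap (b.f p).hom := by
  rintro _ ⟨x, rfl⟩
  exact ⟨(a.f p).hom x, (congrArg (fun g : C ⟶ D' => (g.f p).hom x) h).symm⟩

/-- The map induced on quotient complexes by a commutative square. -/
noncomputable def quotientMap {f : C ⟶ D} {f' : C' ⟶ D'} (a : C ⟶ C') (b : D ⟶ D')
    (h : f ≫ b = a ≫ f') : quotientComplex f ⟶ quotientComplex f' where
  f p := ModuleCat.ofHom (Submodule.mapQ _ _ (b.f p).hom (range_le_comap_map a b h p))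
  comm' p q _ := by
    refine ModuleCat.hom_ext (Submodule.linearMap_qext _ (LinearMap.ext fun x => ?_))
    exact congrArg Submodule.Quotient.mk (congrArg (fun g => g.hom x) (b.comm p q))

end Quotient

/-- The complex `C^{•-1}`: zero in degree `0` and `C^p` in degree `p + 1`, with the differential
of `C` (no sign). -/
noncomputable def degreeShift (C : CochainComplex (ModuleCat.{u} ℂ) ℕ) :
    CochainComplex (ModuleCat.{u} ℂ) ℕ :=
  C.augment (X := ModuleCat.of ℂ PUnit.{u + 1}) 0 Limits.zero_comp

/-- The morphism `C^• → D^{•-1}` given by maps `C^{p+1} → D^p` that commute with the differentials. -/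
noncomputable def toDegreeShift {C D : CochainComplex (ModuleCat.{u} ℂ) ℕ} (r : ∀ p, C.X (p + 1) ⟶ D.X p)
    (h0 : C.d 0 1 ≫ r 0 = 0) (h : ∀ p, r p ≫ D.d p (p + 1) = C.d (p + 1) (p + 2) ≫ r (p + 1)) :
    C ⟶ degreeShift D :=
  CochainComplex.ofHom (fun | 0 => 0 | p + 1 => r p) fun
    | 0 => by
      change (0 : C.X 0 ⟶ _) ≫ _ = C.d 0 1 ≫ r 0
      rw [h0]; exact Limits.zero_comp
    | p + 1 => h p

/-- The morphism `C^{•-1} → D^{•-1}` induced by `C^• → D^•`. -/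
noncomputable def degreeShiftMap {C D : CochainComplex (ModuleCat.{u} ℂ) ℕ} (f : C ⟶ D) :
    degreeShift C ⟶ degreeShift D :=
  CochainComplex.ofHom (fun | 0 => 𝟙 _ | p + 1 => f.f p) fun
    | 0 => (Limits.comp_zero (f := 𝟙 (ModuleCat.of ℂ PUnit.{u + 1}))).trans
        (Limits.zero_comp (f := f.f 0)).symm
    | p + 1 => f.comm p (p + 1)

/-- A morphism between subcomplexes, from linear maps that commute with the exterior derivative. -/
noncomputable def Subcomplex.hom {F : Type u} [NormedAddCommGroup F] [NormedSpace ℂ F] {U : Set E}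
    {V : Set F} {M : Subcomplex U} {N : Subcomplex V} (φ : ∀ p, M.carrier p →ₗ[ℂ] N.carrier p)
    (h : ∀ p ω, N.d p (φ p ω) = φ (p + 1) (M.d p ω)) : M.toComplex ⟶ N.toComplex :=
  CochainComplex.ofHom (fun p => ModuleCat.ofHom (φ p)) fun p => by
    dsimp only [toComplex]
    rw [CochainComplex.of_d, CochainComplex.of_d]
    exact ModuleCat.hom_ext (LinearMap.ext (h p))

/-- A morphism `M^• → N^{•-1}` between subcomplexes, given degree by degree. -/
noncomputable def Subcomplex.shiftHom {F : Type u} [NormedAddCommGroup F] [NormedSpace ℂ F]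
    {U : Set E} {V : Set F} {M : Subcomplex U} {N : Subcomplex V}
    (r : ∀ p, M.carrier (p + 1) →ₗ[ℂ] N.carrier p) (h0 : ∀ ω, r 0 (M.d 0 ω) = 0)
    (h : ∀ p ω, N.d p (r p ω) = r (p + 1) (M.d (p + 1) ω)) :
    M.toComplex ⟶ degreeShift N.toComplex :=
  toDegreeShift (fun p => ModuleCat.ofHom (r p))
    ((congrArg (fun g => g ≫ ModuleCat.ofHom (r 0)) (M.toComplex_d 0)).trans
      (ModuleCat.hom_ext (LinearMap.ext h0)))
    fun p => (congrArg (fun g => ModuleCat.ofHom (r p) ≫ g) (N.toComplex_d p)).trans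
      ((ModuleCat.hom_ext (LinearMap.ext (h p))).trans
        (congrArg (fun g => g ≫ ModuleCat.ofHom (r (p + 1))) (M.toComplex_d (p + 1))).symm)

/-- The morphism `D / C → (D' / C')^{•-1}` induced by a commutative square. -/
noncomputable def quotientShiftMap {C D C' D' : CochainComplex (ModuleCat.{u} ℂ) ℕ} {f : C ⟶ D}
    {f' : C' ⟶ D'} (a : C ⟶ degreeShift C') (b : D ⟶ degreeShift D')
    (h : f ≫ b = a ≫ degreeShiftMap f') :
    quotientComplex f ⟶ degreeShift (quotientComplex f') :=
  toDegreeShift (fun p => ModuleCat.ofHom (Submodule.mapQ _ _ (b.f (p + 1)).hom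
      (range_le_comap_map a b h (p + 1))))
    (by
      refine ModuleCat.hom_ext (Submodule.linearMap_qext _ (LinearMap.ext fun x => ?_))
      refine congrArg Submodule.Quotient.mk
        ((congrArg (fun g => g.hom x) (b.comm 0 1)).symm.trans ?_)
      change ((degreeShift D').d 0 1).hom ((b.f 0).hom x) = 0
      rfl)
    fun p => by
      refine ModuleCat.hom_ext (Submodule.linearMap_qext _ (LinearMap.ext fun x => ?_))
      exact congrArg Submodule.Quotient.mk (congrArg (fun g => g.hom x) (b.comm (p + 1) (p + 2)))

end Cx

namespace CentralArrangement

variable {E : Type u} [NormedAddCommGroup E] [NormedSpace ℂ E] [FiniteDimensional ℂ E]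

/-- `Ω^•⟨A⟩` as a subcomplex of the complex of holomorphic forms on the complement of `A`. -/
noncomputable def logSubcomplex (A : CentralArrangement E) : Subcomplex A.complement where
  isOpen := A.isOpen_complement
  carrier := A.logForms
  le_holForms := A.logForms_le_holForms
  dOn_mem := dOn_mem_logForms

/-- `W_k Ω^•⟨A⟩` as a subcomplex of the complex of holomorphic forms on the complement of `A`. -/
noncomputable def weightSubcomplex (A : CentralArrangement E) (k : ℤ) :
    Subcomplex A.complement where
  isOpen := A.isOpen_complement
  carrier := A.weight k
  le_holForms := A.weight_le_holForms k
  dOn_mem := dOn_mem_weight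

/-- The complex of logarithmic forms `Ω^•⟨A⟩`. -/
noncomputable def logComplex (A : CentralArrangement E) : CochainComplex (ModuleCat.{u} ℂ) ℕ :=
  A.logSubcomplex.toComplex

/-- The complex `W_k Ω^•⟨A⟩`. -/
noncomputable def weightComplex (A : CentralArrangement E) (k : ℤ) :
    CochainComplex (ModuleCat.{u} ℂ) ℕ :=
  (A.weightSubcomplex k).toComplex

/-- The inclusion of `Ω^p⟨A'⟩` in `Ω^p⟨A⟩`, for `A'` the deletion: the restriction of forms to
the smaller complement. -/
noncomputable def inclForms (A : CentralArrangement E) (H : Submodule ℂ E) (p : ℕ) :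
    (A.deletion H).logForms p →ₗ[ℂ] A.logForms p :=
  (cut A.complement).restrict fun _ h => cut_mem_logForms H h

/-- The inclusion of `W_k Ω^p⟨A'⟩` in `W_k Ω^p⟨A⟩`. -/
noncomputable def inclWeight (A : CentralArrangement E) (H : Submodule ℂ E) (k : ℤ) (p : ℕ) :
    (A.deletion H).weight k p →ₗ[ℂ] A.weight k p :=
  (cut A.complement).restrict fun _ h => cut_mem_weight H h

theorem dOn_cut_deletion (A : CentralArrangement E) (H : Submodule ℂ E) {p : ℕ} (ω : Form E p) :
    dOn A.complement (cut A.complement ω) =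
      cut A.complement (dOn (A.deletion H).complement ω) := by
  rw [dOn_cut A.isOpen_complement subset_rfl]
  exact (cut_cut (A.complement_subset_deletion H) _).symm

/-- The inclusion `Ω^•⟨A'⟩ → Ω^•⟨A⟩`. -/
noncomputable def logIncl (A : CentralArrangement E) (H : Submodule ℂ E) :
    (A.deletion H).logComplex ⟶ A.logComplex :=
  Subcomplex.hom (M := (A.deletion H).logSubcomplex) (N := A.logSubcomplex) (A.inclForms H)
    fun _ ω => Subtype.ext (A.dOn_cut_deletion H ω.1)

/-- The inclusion `W_k Ω^•⟨A'⟩ → W_k Ω^•⟨A⟩`. -/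
noncomputable def weightIncl (A : CentralArrangement E) (H : Submodule ℂ E) (k : ℤ) :
    (A.deletion H).weightComplex k ⟶ A.weightComplex k :=
  Subcomplex.hom (M := (A.deletion H).weightSubcomplex k) (N := A.weightSubcomplex k)
    (A.inclWeight H k) fun _ ω => Subtype.ext (A.dOn_cut_deletion H ω.1)

/-- The inclusion `W_{k-1} → W_k`. -/
noncomputable def weightStep (A : CentralArrangement E) (k : ℤ) :
    A.weightComplex (k - 1) ⟶ A.weightComplex k :=
  Subcomplex.hom (M := A.weightSubcomplex (k - 1)) (N := A.weightSubcomplex k)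
    (fun p => Submodule.inclusion (A.weight_mono (sub_le_self k zero_le_one) p)) fun _ _ => rfl

/-- The graded piece `gr_k^W Ω^•⟨A⟩ = W_k / W_{k-1}`. -/
noncomputable def grComplex (A : CentralArrangement E) (k : ℤ) :
    CochainComplex (ModuleCat.{u} ℂ) ℕ :=
  quotientComplex (A.weightStep k)

/-- The morphism `gr_k^W Ω^•⟨A'⟩ → gr_k^W Ω^•⟨A⟩` induced by the inclusion. -/
noncomputable def grIncl (A : CentralArrangement E) (H : Submodule ℂ E) (k : ℤ) :
    (A.deletion H).grComplex k ⟶ A.grComplex k :=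
  quotientMap (A.weightIncl H (k - 1)) (A.weightIncl H k) rfl

/-! ### Residues -/

variable (A : CentralArrangement E) {H : Submodule ℂ E} (hH : H ∈ A.hyperplanes)

theorem logForms_decomp (hH : H ∈ A.hyperplanes) {p : ℕ} {ω : Form E (p + 1)} (h : ω ∈ A.logForms (p + 1)) :
    ∃ α ∈ (A.deletion H).logForms p, ∃ β ∈ (A.deletion H).logForms (p + 1),
      ω = wedgeLog H α + cut A.complement β := by
  obtain ⟨k, hk⟩ := exists_mem_weight h
  obtain ⟨α, hα, β, hβ, e⟩ := weight_decomp_succ hH hk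
  exact ⟨α, weight_le_logForms _ _ _ hα, β, weight_le_logForms _ _ _ hβ, e⟩

variable {A} in
theorem pull_mem_logForms {p : ℕ} {α : Form E p} (h : α ∈ (A.deletion H).logForms p) :
    pull H α ∈ (A.restriction hH).logForms p := by
  obtain ⟨k, hk⟩ := exists_mem_weight h
  exact weight_le_logForms _ _ _ (pull_mem_weight hH hk)

theorem pull_congr (hH : H ∈ A.hyperplanes) {p : ℕ} {α α' : Form E p} {β β' : Form E (p + 1)}
    (hα : α ∈ (A.deletion H).logForms p) (hα' : α' ∈ (A.deletion H).logForms p)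
    (hβ : β ∈ (A.deletion H).logForms (p + 1)) (hβ' : β' ∈ (A.deletion H).logForms (p + 1))
    (h : wedgeLog H α + cut A.complement β = wedgeLog H α' + cut A.complement β') :
    pull H α = pull H α' := by
  rw [← sub_eq_zero, ← map_sub]
  refine pull_unique hH (logForms_le_holForms _ _ (sub_mem hα hα'))
    (logForms_le_holForms _ _ (sub_mem hβ hβ')) ?_
  rw [map_sub, map_sub, sub_add_sub_comm, h, sub_self]

/-- The value of the residue along `H`, see `residue`. -/
noncomputable def residueFun (p : ℕ) (ω : A.logForms (p + 1)) : (A.restriction hH).logForms p :=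
  ⟨(2 * Real.pi * Complex.I : ℂ) • pull H (A.logForms_decomp hH ω.2).choose,
    Submodule.smul_mem _ _ (pull_mem_logForms hH (A.logForms_decomp hH ω.2).choose_spec.1)⟩

theorem residueFun_eq {p : ℕ} (ω : A.logForms (p + 1)) {α : Form E p} {β : Form E (p + 1)}
    (hα : α ∈ (A.deletion H).logForms p) (hβ : β ∈ (A.deletion H).logForms (p + 1))
    (h : ω.1 = wedgeLog H α + cut A.complement β) :
    (A.residueFun hH p ω).1 = (2 * Real.pi * Complex.I : ℂ) • pull H α := by
  obtain ⟨hα', β', hβ', h'⟩ := (A.logForms_decomp hH ω.2).choose_spec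
  exact congrArg (fun w => (2 * Real.pi * Complex.I : ℂ) • w)
    (A.pull_congr hH hα' hα hβ' hβ (h'.symm.trans h))

/-- The residue along `H`: if `ω = α ∧ ω_H + β` with `α` and `β` logarithmic along the deletion, then
`Res ω = 2 π i α|_H`. It does not depend on the choice of `α` and `β`, see `residue_eq`. -/
noncomputable def residue (p : ℕ) : A.logForms (p + 1) →ₗ[ℂ] (A.restriction hH).logForms p where
  toFun := A.residueFun hH p
  map_add' ω ω' := by
    obtain ⟨α, hα, β, hβ, h⟩ := A.logForms_decomp hH ω.2
    obtain ⟨α', hα', β', hβ', h'⟩ := A.logForms_decomp hH ω'.2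
    refine Subtype.ext ?_
    have e : (ω + ω').1 = wedgeLog H (α + α') + cut A.complement (β + β') := by
      rw [Submodule.coe_add, h, h', map_add, map_add, add_add_add_comm]
    rw [A.residueFun_eq hH _ (add_mem hα hα') (add_mem hβ hβ') e, Submodule.coe_add,
      A.residueFun_eq hH ω hα hβ h, A.residueFun_eq hH ω' hα' hβ' h', map_add, smul_add]
  map_smul' c ω := by
    obtain ⟨α, hα, β, hβ, h⟩ := A.logForms_decomp hH ω.2
    refine Subtype.ext ?_
    have e : (c • ω).1 = wedgeLog H (c • α) + cut A.complement (c • β) := by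
      rw [Submodule.coe_smul, h, map_smul, map_smul, smul_add]
    rw [A.residueFun_eq hH _ (Submodule.smul_mem _ c hα) (Submodule.smul_mem _ c hβ) e,
      RingHom.id_apply, Submodule.coe_smul, A.residueFun_eq hH ω hα hβ h, map_smul, smul_comm]

/-- The residue can be computed from any decomposition `ω = α ∧ ω_H + β`. -/
theorem residue_eq {p : ℕ} (ω : A.logForms (p + 1)) {α : Form E p} {β : Form E (p + 1)}
    (hα : α ∈ (A.deletion H).logForms p) (hβ : β ∈ (A.deletion H).logForms (p + 1))
    (h : ω.1 = wedgeLog H α + cut A.complement β) :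
    (A.residue hH p ω).1 = (2 * Real.pi * Complex.I : ℂ) • pull H α :=
  A.residueFun_eq hH ω hα hβ h

theorem residue_mem_weight {k : ℤ} {p : ℕ} (ω : A.logForms (p + 1))
    (h : ω.1 ∈ A.weight k (p + 1)) :
    (A.residue hH p ω).1 ∈ (A.restriction hH).weight (k - 1) p := by
  obtain ⟨α, hα, β, hβ, e⟩ := weight_decomp_succ hH h
  rw [A.residue_eq hH ω (weight_le_logForms _ _ _ hα) (weight_le_logForms _ _ _ hβ) e]
  exact Submodule.smul_mem _ _ (pull_mem_weight hH hα)

/-- The residue `W_k Ω^{p+1}⟨A⟩ → W_{k-1} Ω^p⟨A''⟩`, for `A''` the restriction. -/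
noncomputable def weightResidue (k : ℤ) (p : ℕ) :
    A.weight k (p + 1) →ₗ[ℂ] (A.restriction hH).weight (k - 1) p :=
  LinearMap.codRestrict _ ((Submodule.subtype _) ∘ₗ A.residue hH p ∘ₗ
    Submodule.inclusion (A.weight_le_logForms k (p + 1)))
    fun ω => A.residue_mem_weight hH _ ω.2

theorem residue_cut {p : ℕ} (ω : A.logForms (p + 1)) {β : Form E (p + 1)}
    (hβ : β ∈ (A.deletion H).logForms (p + 1)) (h : ω.1 = cut A.complement β) :
    A.residue hH p ω = 0 := by
  refine Subtype.ext ?_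
  rw [A.residue_eq hH ω (zero_mem _) hβ (by rw [map_zero, zero_add, h]), map_zero, smul_zero]
  rfl

theorem dOn_wedgeLog_deletion (hH : H ∈ A.hyperplanes) {p : ℕ} {α : Form E p}
    (hα : α ∈ holForms (A.deletion H).complement p) :
    dOn A.complement (wedgeLog H α) = wedgeLog H (dOn (A.deletion H).complement α) := by
  have hHc := A.isCoatom H hH
  rw [dOn_wedgeLog (U := A.complement) hHc (fun x hx => hx H hH)
    fun x hx => (holForms_analyticAt hα (A.complement_subset_deletion H hx)).differentiableAt]
  refine Form.ext fun x => ?_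
  rw [wedgeLog_apply, wedgeLog_apply]
  by_cases hxH : x ∈ H
  · rw [logForm_of_mem hHc hxH, wedge_zero_right, wedge_zero_right]
  · by_cases hx : x ∈ A.complement
    · rw [dOn_of_mem _ hx, dOn_of_mem _ (A.complement_subset_deletion H hx)]
    · have hx' : x ∉ (A.deletion H).complement := fun h => hx (mem_complement_of_deletion h hxH)
      rw [dOn_of_notMem _ hx, dOn_of_notMem _ hx']

/-- `Res (dω) = d (Res ω)`. -/
theorem residue_d {p : ℕ} (ω : A.logForms (p + 1)) :
    A.residue hH (p + 1) (A.logSubcomplex.d (p + 1) ω) =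
      (A.restriction hH).logSubcomplex.d p (A.residue hH p ω) := by
  obtain ⟨α, hα, β, hβ, h⟩ := A.logForms_decomp hH ω.2
  refine Subtype.ext ?_
  change _ = dOn (A.restriction hH).complement (A.residue hH p ω).1
  rw [A.residue_eq hH ω hα hβ h, dOn_smul, complement_restriction,
    ← pull_dOn H (logForms_le_holForms _ _ hα)]
  refine A.residue_eq hH _ (dOn_mem_logForms hα) (dOn_mem_logForms hβ) ?_
  change dOn A.complement ω.1 = _
  have h1 := A.logForms_le_holForms _ (cut_mem_logForms (A := A) H hβ)
  have h2 : wedgeLog H α ∈ holForms A.complement (p + 1) := by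
    have e : wedgeLog H α = ω.1 - cut A.complement β := by rw [h, add_sub_cancel_right]
    rw [e]
    exact sub_mem (A.logForms_le_holForms _ ω.2) h1
  rw [h, dOn_add h2 h1, A.dOn_wedgeLog_deletion hH (logForms_le_holForms _ _ hα),
    A.dOn_cut_deletion H β]

theorem residue_d_zero (ω : A.logForms 0) : A.residue hH 0 (A.logSubcomplex.d 0 ω) = 0 := by
  obtain ⟨k, hk⟩ := exists_mem_weight ω.2
  obtain ⟨β, hβ, e⟩ := weight_decomp_zero hH hk
  refine A.residue_cut hH _ (dOn_mem_logForms (weight_le_logForms _ _ _ hβ)) ?_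
  change dOn A.complement ω.1 = _
  rw [e, A.dOn_cut_deletion H β]

/-- The residue morphism `Ω^•⟨A⟩ → Ω^{•-1}⟨A''⟩`. -/
noncomputable def logRes : A.logComplex ⟶ degreeShift (A.restriction hH).logComplex :=
  Subcomplex.shiftHom (M := A.logSubcomplex) (N := (A.restriction hH).logSubcomplex)
    (A.residue hH) (A.residue_d_zero hH) fun _ ω => (A.residue_d hH ω).symm

/-- The residue morphism `W_k Ω^•⟨A⟩ → W_{k-1} Ω^{•-1}⟨A''⟩`. -/
noncomputable def weightRes (k : ℤ) :
    A.weightComplex k ⟶ degreeShift ((A.restriction hH).weightComplex (k - 1)) :=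
  Subcomplex.shiftHom (M := A.weightSubcomplex k)
    (N := (A.restriction hH).weightSubcomplex (k - 1)) (A.weightResidue hH k)
    (fun ω => by
      have h := congrArg Subtype.val
        (A.residue_d_zero hH ⟨ω.1, A.weight_le_logForms _ _ ω.2⟩)
      exact Subtype.ext h)
    fun _ ω => by
      have h := congrArg Subtype.val (A.residue_d hH ⟨ω.1, A.weight_le_logForms _ _ ω.2⟩)
      exact Subtype.ext h.symm

theorem weightStep_weightRes (k : ℤ) : A.weightStep k ≫ A.weightRes hH k =
    A.weightRes hH (k - 1) ≫ degreeShiftMap ((A.restriction hH).weightStep (k - 1)) :=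
  HomologicalComplex.hom_ext _ _ fun
    | 0 => rfl
    | _ + 1 => rfl

/-- The residue morphism `gr_k^W Ω^•⟨A⟩ → gr_{k-1}^W Ω^{•-1}⟨A''⟩`. -/
noncomputable def grRes (k : ℤ) :
    A.grComplex k ⟶ degreeShift ((A.restriction hH).grComplex (k - 1)) :=
  quotientShiftMap (A.weightRes hH (k - 1)) (A.weightRes hH k) (A.weightStep_weightRes hH k)

theorem residue_inclForms (p : ℕ) (ω : (A.deletion H).logForms (p + 1)) :
    A.residue hH p (A.inclForms H (p + 1) ω) = 0 := A.residue_cut hH _ ω.2 rfl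

theorem logIncl_logRes : A.logIncl H ≫ A.logRes hH = 0 :=
  HomologicalComplex.hom_ext _ _ fun
    | 0 => rfl
    | p + 1 => ModuleCat.hom_ext (LinearMap.ext (A.residue_inclForms hH p))

theorem weightIncl_weightRes (k : ℤ) : A.weightIncl H k ≫ A.weightRes hH k = 0 :=
  HomologicalComplex.hom_ext _ _ fun
    | 0 => rfl
    | p + 1 => ModuleCat.hom_ext (LinearMap.ext fun ω => by
        have h := congrArg Subtype.val
          (A.residue_inclForms hH p ⟨ω.1, weight_le_logForms _ _ _ ω.2⟩)
        exact Subtype.ext h)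

theorem grIncl_grRes (k : ℤ) : A.grIncl H k ≫ A.grRes hH k = 0 :=
  HomologicalComplex.hom_ext _ _ fun
    | 0 => ModuleCat.hom_ext (LinearMap.ext fun _ => rfl)
    | p + 1 => ModuleCat.hom_ext (Submodule.linearMap_qext _ (LinearMap.ext fun x =>
        congrArg Submodule.Quotient.mk (congrArg (fun g : (A.deletion H).weightComplex k ⟶
          degreeShift ((A.restriction hH).weightComplex (k - 1)) => (g.f (p + 1)).hom x)
          (A.weightIncl_weightRes hH k))))

/-- The residue sequence `Ω^•⟨A'⟩ → Ω^•⟨A⟩ → Ω^{•-1}⟨A''⟩`. -/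
noncomputable def logSeq : ShortComplex (CochainComplex (ModuleCat.{u} ℂ) ℕ) :=
  ShortComplex.mk (A.logIncl H) (A.logRes hH) (A.logIncl_logRes hH)

/-- The sequence `W_k Ω^•⟨A'⟩ → W_k Ω^•⟨A⟩ → W_{k-1} Ω^{•-1}⟨A''⟩`. -/
noncomputable def weightSeq (k : ℤ) : ShortComplex (CochainComplex (ModuleCat.{u} ℂ) ℕ) :=
  ShortComplex.mk (A.weightIncl H k) (A.weightRes hH k) (A.weightIncl_weightRes hH k)

/-- The sequence `gr_k^W Ω^•⟨A'⟩ → gr_k^W Ω^•⟨A⟩ → gr_{k-1}^W Ω^{•-1}⟨A''⟩`. -/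
noncomputable def grSeq (k : ℤ) : ShortComplex (CochainComplex (ModuleCat.{u} ℂ) ℕ) :=
  ShortComplex.mk (A.grIncl H k) (A.grRes hH k) (A.grIncl_grRes hH k)

end CentralArrangement

end LogForms

/-!
The injectivity of the inclusion is the identity principle, and the residue is surjective because a
monomial `η ∧ ω_I` on `H` lifts: `η` is pulled back along a projection onto `H`, and each hyperplane
of the restriction is cut out by some member of the deletion. The sequence of graded pieces follows
from the two sequences for `W_k` and `W_{k-1}`. The content is exactness in the middle: a form of
weight `k` with zero residue along `H` lies in `W_k` of the deletion.

This is the case `S = {H}` of `mem_regularPart_of_mem_vanishing`. Let `S` be an independent subset of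
an arrangement `B` such that no other member of `B` contains the intersection `F` of `S`. If `ω` has
weight `k` and `∏_{H ∈ S} f_H • ω`, extended across the members of `S`, vanishes along `F`, then `ω` is
a sum of forms of weight `k`, each without pole along some member of `S`. The proof is by induction on
the number of members `X` of `B` outside `S`.

* If another member `Y` outside `S` contains `F ∩ X`, the relations of Arnold and Orlik–Solomon
  (`wedgeLog_sub_mem_regularPart`) allow to replace the factor `ω_X` by `ω_Y` in `ω`.
* Otherwise the statement for `S ∪ {X}` applies to `ω`.

In both cases the pole along `X` disappears, up to forms of the required kind, and the statement for
`B \ {X}` concludes. When `B = S`, the monomials that matter contain all the `ω_H`, so that `ω` is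
the quotient by `∏ f_H` of an entire form `φ` which is killed by all the `∧ df_H` and vanishes on `F`.
Dividing by one equation after the other (`mem_iSup_mulForm_of_eq_zero`, which rests on Hadamard's
lemma `exists_analyticOnNhd_sub_eq_smul`) gives `φ = ∑ f_H φ_H` with `φ_H` killed by the same forms; each
`φ_H / ∏ f` is logarithmic (`cut_mulForm_inv_mem_weight`), and the factor `f_H` removes its pole
along `H`.
-/

/-! ### Division of a holomorphic function by a linear form -/

namespace LogForms

section Division

variable {E V : Type*} [NormedAddCommGroup E] [NormedSpace ℂ E] [NormedAddCommGroup V]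
  [NormedSpace ℂ V]

/-- The homogeneous part of degree `n` of the quotient by `f` of `∑ pₙ(zⁿ) - ∑ pₙ((π z)ⁿ)`, where
`z - π z = f z • e`: the sum of the values of `pₙ₊₁` with `e` in one slot, `z` in the slots before it
and `π z` in the slots after it. -/
noncomputable def divSeries (p : FormalMultilinearSeries ℂ E V) (π : E →L[ℂ] E) (e : E) :
    FormalMultilinearSeries ℂ E V := fun n =>
  ∑ j : Fin (n + 1), ((p (n + 1)).curryMid j e).compContinuousLinearMap
    fun i : Fin n => if i.castSucc < j then ContinuousLinearMap.id ℂ E else π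

theorem smul_divSeries_apply (p : FormalMultilinearSeries ℂ E V) {π : E →L[ℂ] E} {e z : E} {c : ℂ}
    (h : z - π z = c • e) (n : ℕ) :
    c • divSeries p π e n (fun _ => z) = p (n + 1) (fun _ => z) - p (n + 1) (fun _ => π z) := by
  have key := (p (n + 1)).toMultilinearMap.map_piecewise_sub_map_piecewise
    (fun _ => z) (fun _ => π z) (fun _ => z) Finset.univ
  simp only [Finset.piecewise_univ, Finset.mem_univ, if_true] at key
  refine Eq.trans ?_ key.symm
  rw [divSeries, sum_apply, Finset.smul_sum]
  refine Finset.sum_congr rfl fun j _ => ?_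
  rw [ContinuousMultilinearMap.compContinuousLinearMap_apply, ← smul_apply,
    ← ContinuousLinearMap.map_smul_of_tower, ContinuousMultilinearMap.curryMid_apply, h.symm]
  refine congrArg (p (n + 1)) (funext fun k => ?_)
  refine Fin.succAboveCases j ?_ (fun i => ?_) k
  · simp
  · rw [Fin.insertNth_apply_succAbove, if_neg (Fin.succAbove_ne j i)]
    by_cases hij : i.castSucc < j
    · simp [hij, Fin.succAbove_of_castSucc_lt]
    · have h2 : ¬ j.succAbove i < j := by
        rw [Fin.succAbove_of_le_castSucc _ _ (not_lt.mp hij), not_lt]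
        exact (not_lt.mp hij).trans (Fin.castSucc_lt_succ).le
      simp [hij, h2]

theorem norm_divSeries_le (p : FormalMultilinearSeries ℂ E V) (π : E →L[ℂ] E) (e : E) (n : ℕ) :
    ‖divSeries p π e n‖ ≤ (n + 1) * (‖p (n + 1)‖ * ‖e‖ * (‖π‖ + 1) ^ n) := by
  refine (norm_sum_le _ _).trans ?_
  have h : ∀ j ∈ (Finset.univ : Finset (Fin (n + 1))),
      ‖((p (n + 1)).curryMid j e).compContinuousLinearMap
        fun i : Fin n => if i.castSucc < j then ContinuousLinearMap.id ℂ E else π‖ ≤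
      ‖p (n + 1)‖ * ‖e‖ * (‖π‖ + 1) ^ n := by
    intro j _
    refine (ContinuousMultilinearMap.norm_compContinuousLinearMap_le _ _).trans ?_
    refine mul_le_mul ?_ ?_ (Finset.prod_nonneg fun _ _ => norm_nonneg _) (by positivity)
    · refine ((ContinuousLinearMap.le_opNorm _ _).trans_eq ?_)
      rw [ContinuousMultilinearMap.norm_curryMid]
    · refine (Finset.prod_le_prod (g := fun _ => ‖π‖ + 1) (fun _ _ => norm_nonneg _)
        fun i _ => ?_).trans_eq (by simp)
      split_ifs
      · exact ContinuousLinearMap.norm_id_le.trans (by linarith [norm_nonneg π])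
      · linarith
  refine (Finset.sum_le_sum h).trans_eq ?_
  simp

theorem divSeries_radius_pos {p : FormalMultilinearSeries ℂ E V} (hp : 0 < p.radius)
    (π : E →L[ℂ] E) (e : E) : 0 < (divSeries p π e).radius := by
  obtain ⟨r, hr0, hr⟩ := ENNReal.lt_iff_exists_nnreal_btwn.mp hp
  have hr0' : (0 : ℝ) < r := by exact_mod_cast hr0
  obtain ⟨C, hC, hpC⟩ := p.norm_mul_pow_le_of_lt_radius hr
  set M : NNReal := ⟨‖π‖ + 1, by positivity⟩ with hM
  have hMv : (M : ℝ) = ‖π‖ + 1 := rfl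
  have hM0 : (0 : ℝ) < M := by rw [hMv]; positivity
  -- The factor `2` in the radius absorbs the number `n + 1` of summands of the `n`-th coefficient.
  have hle : (((r / (2 * M) : NNReal)) : ENNReal) ≤ (divSeries p π e).radius := by
    refine FormalMultilinearSeries.le_radius_of_bound _ (C * ‖e‖ / r) fun n => ?_
    have h1 := norm_divSeries_le p π e n
    have h2 := hpC (n + 1)
    have h3 : ((n : ℝ) + 1) ≤ 2 ^ n := by
      have := Nat.lt_two_pow_self (n := n)
      exact_mod_cast this
    calc ‖divSeries p π e n‖ * ((r / (2 * M) : NNReal) : ℝ) ^ n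
        ≤ ((n + 1) * (‖p (n + 1)‖ * ‖e‖ * (M : ℝ) ^ n)) * ((r : ℝ) / (2 * M)) ^ n := by
          push_cast
          gcongr
          exact h1
      _ = ((n + 1) / 2 ^ n) * ((‖p (n + 1)‖ * (r : ℝ) ^ (n + 1)) * ‖e‖ / r) := by
          rw [div_pow, mul_pow, pow_succ]
          field_simp
      _ ≤ 1 * (C * ‖e‖ / r) := by
          gcongr
          rw [div_le_one (by positivity)]
          exact h3
      _ = _ := one_mul _
  refine lt_of_lt_of_le ?_ hle
  have : 0 < r / (2 * M) := div_pos (by exact_mod_cast hr0) (mul_pos two_pos (by exact_mod_cast hM0))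
  exact_mod_cast this

/-- Near a point of the hyperplane `{f = 0}`, the difference `φ(x) - φ(x - f(x) e)` is divisible by
`f`. -/
theorem exists_eventually_sub_eq_smul [CompleteSpace V] {φ : E → V} {x₀ : E}
    (hφ : AnalyticAt ℂ φ x₀) (f : E →L[ℂ] ℂ) (e : E) (hx₀ : f x₀ = 0) :
    ∃ m : E → V, AnalyticAt ℂ m x₀ ∧ ∀ᶠ x in nhds x₀, φ x - φ (x - f x • e) = f x • m x := by
  obtain ⟨p, r, hp⟩ := hφ
  set π : E →L[ℂ] E := ContinuousLinearMap.id ℂ E - f.smulRight e with hπ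
  set q := divSeries p π e
  have hq : 0 < q.radius := divSeries_radius_pos (hp.r_pos.trans_le hp.r_le) π e
  have hqs := (q.hasFPowerSeriesOnBall hq).comp_sub x₀
  rw [zero_add] at hqs
  refine ⟨fun x => q.sum (x - x₀), hqs.analyticAt, ?_⟩
  have hball : ∀ᶠ z in nhds (0 : E), z ∈ Metric.eball (0 : E) r :=
    Metric.eball_mem_nhds _ hp.r_pos
  have hball2 : ∀ᶠ z in nhds (0 : E), z ∈ Metric.eball (0 : E) q.radius :=
    Metric.eball_mem_nhds _ hq
  have hball3 : ∀ᶠ z in nhds (0 : E), π z ∈ Metric.eball (0 : E) r :=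
    (by simpa using π.continuous.tendsto 0 : Filter.Tendsto π (nhds 0) (nhds 0)).eventually hball
  have hshift : Filter.Tendsto (fun x => x - x₀) (nhds x₀) (nhds 0) := by
    simpa using (continuous_id.sub continuous_const).tendsto (f := fun x : E => x - x₀) x₀
  filter_upwards [hshift.eventually hball, hshift.eventually hball2, hshift.eventually hball3]
    with x h1 h2 h3
  have s1 := hp.hasSum h1
  have s3 := hp.hasSum h3
  have hx : f (x - x₀) = f x := by rw [map_sub, hx₀, sub_zero]
  have e1 : x₀ + (x - x₀) = x := by abel
  have e3 : x₀ + π (x - x₀) = x - f x • e := by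
    simp only [hπ, sub_apply, ContinuousLinearMap.id_apply,
      ContinuousLinearMap.smulRight_apply, hx]
    abel
  rw [e1] at s1
  rw [e3] at s3
  have s := s1.sub s3
  rw [← hasSum_nat_add_iff' 1] at s
  have s2 := (q.hasSum h2).const_smul (f x)
  have hz : (x - x₀) - π (x - x₀) = f x • e := by
    simp [hπ, hx]
  simp only [smul_divSeries_apply p hz, q] at s2
  have h0 := s.unique s2
  simp only [Finset.range_one, Finset.sum_singleton] at h0
  rw [← h0, show (p 0 fun _ => x - x₀) = p 0 fun _ => π (x - x₀) from
    congrArg (p 0) (Subsingleton.elim _ _), sub_self, sub_zero]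

/-- **Hadamard's lemma** along a hyperplane, for entire functions: `φ(x) - φ(x - f(x) e)` is the
product of `f` and an entire function. -/
theorem exists_analyticOnNhd_sub_eq_smul [CompleteSpace V] {φ : E → V} (hφ : AnalyticOnNhd ℂ φ Set.univ)
    (f : E →L[ℂ] ℂ) {e : E} (he : f e = 1) :
    ∃ m : E → V, AnalyticOnNhd ℂ m Set.univ ∧ ∀ x, φ x - φ (x - f x • e) = f x • m x := by
  classical
  -- The quotient off `{f = 0}`, and its limit, the derivative in the direction of `e`, on `{f = 0}`.
  let m : E → V := fun x => if f x = 0 then fderiv ℂ φ x e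
    else (f x)⁻¹ • (φ x - φ (x - f x • e))
  have hm : ∀ x, φ x - φ (x - f x • e) = f x • m x := fun x => by
    by_cases h : f x = 0
    · simp [h]
    · simp [m, h]
  refine ⟨m, fun x₀ _ => ?_, hm⟩
  by_cases hx₀ : f x₀ = 0
  · obtain ⟨m₀, hm₀, hev⟩ := exists_eventually_sub_eq_smul (hφ x₀ trivial) f e hx₀
    refine hm₀.congr ?_
    filter_upwards [hev.eventually_nhds, hm₀.eventually_analyticAt] with x hx hmx
    by_cases h : f x = 0
    · have hl : HasDerivAt (fun t : ℂ => x + t • e) e 0 := by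
        simpa using ((hasDerivAt_id (0 : ℂ)).smul_const e).const_add x
      have hl0 : x + (0 : ℂ) • e = x := by simp
      have d1 : HasDerivAt (fun t : ℂ => φ (x + t • e) - φ x) (fderiv ℂ φ x e) 0 := by
        have h1 : HasFDerivAt φ (fderiv ℂ φ x) (x + (0 : ℂ) • e) := by
          rw [hl0]; exact (hφ x trivial).differentiableAt.hasFDerivAt
        exact (h1.comp_hasDerivAt 0 hl).sub_const _
      have d2 : HasDerivAt (fun t : ℂ => t • m₀ (x + t • e)) (m₀ x) 0 := by
        have h1 : HasFDerivAt m₀ (fderiv ℂ m₀ x) (x + (0 : ℂ) • e) := by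
          rw [hl0]; exact hmx.differentiableAt.hasFDerivAt
        have h2 := (hasDerivAt_id (0 : ℂ)).smul (h1.comp_hasDerivAt 0 hl)
        simp only [id, zero_smul, one_smul, zero_add, Function.comp_apply, add_zero] at h2
        exact h2
      have hlt : Filter.Tendsto (fun t : ℂ => x + t • e) (nhds 0) (nhds x) := by
        simpa using hl.continuousAt.tendsto
      have hd : (fun t : ℂ => φ (x + t • e) - φ x) =ᶠ[nhds 0] fun t => t • m₀ (x + t • e) := by
        filter_upwards [hlt.eventually hx] with t ht
        have : f (x + t • e) = t := by simp [h, he]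
        rwa [this, add_sub_cancel_right] at ht
      simp only [m, if_pos h]
      exact (d2.congr_of_eventuallyEq hd).unique d1
    · have := hx.self_of_nhds
      simp only [m, if_neg h, this, smul_smul, inv_mul_cancel₀ h, one_smul]
  · have ha : AnalyticAt ℂ (fun x => (f x)⁻¹ • (φ x - φ (x - f x • e))) x₀ := by
      refine ((f.analyticAt x₀).inv hx₀).smul ((hφ x₀ trivial).sub ?_)
      exact AnalyticAt.fun_comp (g := φ) (hφ _ trivial)
        (analyticAt_id.sub ((f.analyticAt x₀).smul analyticAt_const))
    refine ha.congr ?_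
    filter_upwards [f.continuous.continuousAt.eventually_ne hx₀] with x hx
    simp [m, hx]

end Division

end LogForms

namespace LogForms

/-! ### Contraction of covectors -/

section Covectors

variable {E : Type u} [NormedAddCommGroup E] [NormedSpace ℂ E]

theorem wedge_neg_left {p : ℕ} (η : E [⋀^Fin p]→L[ℂ] ℂ) (θ : E →L[ℂ] ℂ) :
    wedge (-η) θ = -wedge η θ := by
  ext v
  simp [wedge_apply]

theorem wedge_add_right {p : ℕ} (η : E [⋀^Fin p]→L[ℂ] ℂ) (θ θ' : E →L[ℂ] ℂ) :
    wedge η (θ + θ') = wedge η θ + wedge η θ' := by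
  ext v
  simp only [wedge_apply, ContinuousAlternatingMap.add_apply, add_apply, ← Finset.sum_add_distrib]
  exact Finset.sum_congr rfl fun i _ => by ring

theorem wedge_sum_right {ι : Type*} {p : ℕ} (η : E [⋀^Fin p]→L[ℂ] ℂ) (s : Finset ι)
    (θ : ι → E →L[ℂ] ℂ) : wedge η (∑ i ∈ s, θ i) = ∑ i ∈ s, wedge η (θ i) := by
  classical
  induction s using Finset.induction_on with
  | empty => simp [wedge_zero_right]
  | insert i s hi ih => rw [Finset.sum_insert hi, Finset.sum_insert hi, wedge_add_right, ih]

theorem curryLeft_wedge_zero (w : E [⋀^Fin 0]→L[ℂ] ℂ) (f : E →L[ℂ] ℂ) (e : E) :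
    (wedge w f).curryLeft e = f e • w := by
  ext v
  have h : ∀ t : Fin 0 → E, w t = w v := fun t => congrArg w (Subsingleton.elim t v)
  simp [wedge_apply, mul_comm, h]

/-- Contraction with a vector is an antiderivation for the exterior product. -/
theorem curryLeft_wedge {p : ℕ} (w : E [⋀^Fin (p + 1)]→L[ℂ] ℂ) (f : E →L[ℂ] ℂ) (e : E) :
    (wedge w f).curryLeft e = ((-1) ^ (p + 1) * f e) • w + wedge (w.curryLeft e) f := by
  ext v
  simp only [ContinuousAlternatingMap.curryLeft_apply_apply, wedge_apply,
    ContinuousAlternatingMap.add_apply, ContinuousAlternatingMap.smul_apply, smul_eq_mul]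
  rw [Fin.sum_univ_succ]
  congr 1
  · simp only [Fin.val_zero, add_zero, Fin.removeNth_zero, Matrix.vecCons, Fin.tail_cons, Fin.cons_zero]
    ring
  · refine Finset.sum_congr rfl fun i _ => ?_
    have h1 : i.succ.removeNth (Matrix.vecCons e v) = Matrix.vecCons e (i.removeNth v) := by
      simp only [Matrix.vecCons]
      funext j
      refine Fin.cases ?_ (fun j => ?_) j
      · simp [Fin.removeNth]
      · simp [Fin.removeNth]
    rw [h1]
    simp only [Matrix.cons_val_succ, Fin.val_succ]
    ring

/-- A covector killed by `∧ f` is divisible by `f`. -/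
theorem eq_wedge_of_wedge_eq_zero {p : ℕ} {w : E [⋀^Fin (p + 1)]→L[ℂ] ℂ} {f : E →L[ℂ] ℂ} {e : E}
    (he : f e = 1) (h : wedge w f = 0) : w = wedge ((-1 : ℂ) ^ p • w.curryLeft e) f := by
  ext v
  have h1 := congrArg (fun u => u v) (curryLeft_wedge w f e)
  rw [h, he, mul_one] at h1
  rw [wedge_smul]
  simp only [ContinuousAlternatingMap.curryLeft_apply_apply, ContinuousAlternatingMap.add_apply,
    ContinuousAlternatingMap.smul_apply, smul_eq_mul] at h1 ⊢
  change (0 : ℂ) = _ at h1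
  have h2 : ((-1 : ℂ) ^ p) * (-1) ^ p = 1 := by rw [← mul_pow]; simp
  linear_combination (-1 : ℂ) ^ p * h1 - w v * h2

theorem wedge_curryLeft_eq_zero {p : ℕ} {w : E [⋀^Fin (p + 1)]→L[ℂ] ℂ} {f : E →L[ℂ] ℂ} {e : E}
    (he : f e = 0) (h : wedge w f = 0) : wedge (w.curryLeft e) f = 0 := by
  ext v
  have h1 := congrArg (fun u => u v) (curryLeft_wedge w f e)
  rw [h, he, mul_zero] at h1
  simpa using h1.symm

theorem eq_zero_of_wedge_eq_zero {w : E [⋀^Fin 0]→L[ℂ] ℂ} {f : E →L[ℂ] ℂ} {e : E}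
    (he : f e = 1) (h : wedge w f = 0) : w = 0 := by
  ext v
  have h1 := congrArg (fun u => u v) (curryLeft_wedge_zero w f e)
  rw [h, he] at h1
  simpa using h1.symm

/-- A covector vanishes if it vanishes on the vectors of the hyperplane `{f = 0}` and whenever one
of its arguments is a given vector `e` outside that hyperplane. -/
theorem eq_zero_of_apply_ker {f : E →L[ℂ] ℂ} {e : E} (he : f e = 1) {p : ℕ}
    (u : E [⋀^Fin p]→L[ℂ] ℂ) (h : ∀ v, (∀ i, f (v i) = 0) → u v = 0)
    (h' : ∀ v i, v i = e → u v = 0) : u = 0 := by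
  induction p with
  | zero => ext v; exact h v fun i => i.elim0
  | succ p ih =>
    ext v
    have hh : f (v 0 - f (v 0) • e) = 0 := by simp [he]
    have h0 : u.curryLeft (v 0 - f (v 0) • e) = 0 := by
      refine ih _ (fun t ht => h _ (Fin.cases hh ht)) fun t i hi => h' _ i.succ ?_
      simpa using hi
    have h1 : u.curryLeft e = 0 := by
      ext t; exact h' _ 0 (by simp)
    rw [map_sub, map_smul, h1, smul_zero, sub_zero] at h0
    have h2 := congrArg (fun w => w (Fin.tail v)) h0
    simp only [ContinuousAlternatingMap.curryLeft_apply_apply, Matrix.vecCons,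
      Fin.cons_self_tail] at h2
    exact h2

/-- A covector whose restriction to the hyperplane `{f = 0}` vanishes is killed by `∧ f`. -/
theorem wedge_eq_zero_of_comp_eq_zero {H : Submodule ℂ E} {f : E →L[ℂ] ℂ}
    (hf : LinearMap.ker f.toLinearMap = H) {e : E} (he : f e = 1) {p : ℕ}
    {w : E [⋀^Fin p]→L[ℂ] ℂ} (h : w.compContinuousLinearMap H.subtypeL = 0) : wedge w f = 0 := by
  have hw : ∀ v, (∀ i, f (v i) = 0) → w v = 0 := fun v hv => by
    have h1 := congrArg (fun w => w fun i => (⟨v i, hf ▸ (by simpa using hv i)⟩ : H)) h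
    exact h1
  have hu : ∀ v, (∀ i, f (v i) = 0) → wedge w f v = 0 := fun v hv => by
    simp [wedge_apply, hv]
  have hc : (wedge w f).curryLeft e = 0 := by
    refine eq_zero_of_apply_ker he _ (fun v hv => ?_) fun v i hi => ?_
    · rw [ContinuousAlternatingMap.curryLeft_apply_apply, wedge_apply, Fin.sum_univ_succ]
      simp [hv, Matrix.vecCons, Fin.removeNth_zero, hw v hv]
    · rw [ContinuousAlternatingMap.curryLeft_apply_apply]
      exact (wedge w f).map_eq_zero_of_eq _ (i := 0) (j := i.succ) (by simp [hi])
        (Fin.succ_ne_zero i).symm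
  have hz : ∀ v : Fin (p + 1) → E, v 0 = e → wedge w f v = 0 := fun v hv => by
    have h1 := congrArg (fun w => w (Fin.tail v)) hc
    simp only [ContinuousAlternatingMap.curryLeft_apply_apply, Matrix.vecCons, ← hv,
      Fin.cons_self_tail] at h1
    exact h1
  refine eq_zero_of_apply_ker he _ hu fun v i hi => ?_
  by_cases h0 : i = 0
  · exact hz v (h0 ▸ hi)
  · have h1 := (wedge w f).toAlternatingMap.map_swap v (Ne.symm h0)
    have h2 : wedge w f (v ∘ Equiv.swap 0 i) = 0 := hz _ (by simp [hi])
    have h3 : wedge w f (v ∘ Equiv.swap 0 i) = -wedge w f v := h1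
    rw [h2] at h3
    exact neg_eq_zero.mp h3.symm

end Covectors

/-! ### Equations of hyperplanes and density of complements -/

section Equations

variable {E : Type u} [NormedAddCommGroup E] [NormedSpace ℂ E]

open Classical in
/-- A linear equation of the hyperplane `X`. -/
noncomputable def equation (X : Submodule ℂ E) : E →L[ℂ] ℂ :=
  if h : ∃ f : E →L[ℂ] ℂ, LinearMap.ker f.toLinearMap = X then h.choose else 0

/-- The points that lie on no member of `T`. -/
def off (T : Set (Submodule ℂ E)) : Set E := {x | ∀ X ∈ T, x ∉ X}

theorem off_anti {T T' : Set (Submodule ℂ E)} (h : T ⊆ T') : off T' ⊆ off T :=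
  fun _ hx X hX => hx X (h hX)

/-- The product of the equations of the members of `S`. -/
noncomputable def eqProd (S : Finset (Submodule ℂ E)) (x : E) : ℂ := ∏ X ∈ S, equation X x

variable [FiniteDimensional ℂ E]

theorem ker_equation {X : Submodule ℂ E} (hX : IsCoatom X) :
    LinearMap.ker (equation X).toLinearMap = X := by
  have h := exists_form hX
  rw [equation, dif_pos h]
  exact h.choose_spec

theorem equation_eq_zero {X : Submodule ℂ E} (hX : IsCoatom X) {x : E} :
    equation X x = 0 ↔ x ∈ X := by
  conv_rhs => rw [← ker_equation hX]
  simp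

theorem logForm_eq_equation {X : Submodule ℂ E} (hX : IsCoatom X) (x : E) :
    logForm X x = (equation X x)⁻¹ • equation X := logForm_eq (ker_equation hX) x

theorem exists_equation_eq_one {X : Submodule ℂ E} (hX : IsCoatom X) :
    ∃ e, equation X e = 1 := by
  obtain ⟨v, hv⟩ : ∃ v, v ∉ X := by
    by_contra! h
    exact hX.1 (eq_top_iff.mpr fun x _ => h x)
  have h : equation X v ≠ 0 := fun h => hv ((equation_eq_zero hX).1 h)
  exact ⟨(equation X v)⁻¹ • v, by simp [h]⟩

theorem analyticAt_equation (X : Submodule ℂ E) (x : E) :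
    AnalyticAt ℂ (fun y => equation X y) x := (equation X).analyticAt x

theorem analyticAt_eqProd (S : Finset (Submodule ℂ E)) (x : E) : AnalyticAt ℂ (eqProd S) x :=
  Finset.analyticAt_fun_prod S fun X _ => analyticAt_equation X x

theorem eqProd_ne_zero {S : Finset (Submodule ℂ E)} (hS : ∀ X ∈ S, IsCoatom X) {x : E}
    (hx : x ∈ off (S : Set (Submodule ℂ E))) : eqProd S x ≠ 0 :=
  Finset.prod_ne_zero_iff.mpr fun X hX h => hx X hX ((equation_eq_zero (hS X hX)).1 h)

theorem isOpen_off {T : Set (Submodule ℂ E)} (hT : T.Finite) : IsOpen (off T) := by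
  have : off T = ⋂ X ∈ T, (X : Set E)ᶜ := by ext; simp [off]
  rw [this]
  exact hT.isOpen_biInter fun X _ => (Submodule.closed_of_finiteDimensional X).isOpen_compl

/-- The complement in `F` of finitely many linear subspaces that do not contain `F` is dense in `F`. -/
theorem subset_closure_inter_off {F : Submodule ℂ E} {T : Set (Submodule ℂ E)} (hT : T.Finite)
    (h : ∀ Y ∈ T, ¬ F ≤ Y) : (F : Set E) ⊆ closure (F ∩ off T) := by
  have hd : Dense (⋂ Y ∈ T, ((Y.comap F.subtype : Submodule ℂ F) : Set F)ᶜ) := by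
    refine dense_biInter_of_isOpen
      (fun Y _ => (Submodule.closed_of_finiteDimensional _).isOpen_compl) hT.countable
      fun Y hY => ?_
    rw [← interior_eq_empty_iff_dense_compl]
    by_contra hne
    exact h Y hY (Submodule.comap_subtype_eq_top.mp
      (Submodule.eq_top_of_nonempty_interior' _ (Set.nonempty_iff_ne_empty.mpr hne)))
  intro x hx
  have h1 := image_closure_subset_closure_image continuous_subtype_val
    (Set.mem_image_of_mem Subtype.val (hd (⟨x, hx⟩ : F)))
  refine closure_mono ?_ h1
  rintro _ ⟨y, hy, rfl⟩
  refine ⟨y.2, fun Y hY hyY => ?_⟩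
  exact Set.mem_iInter₂.mp hy Y hY hyY

/-- Two continuous functions on an open set `U` that agree at the points of `U ∩ F` off finitely many
linear subspaces not containing `F` agree on `U ∩ F`. -/
theorem eq_of_eq_on_off {V : Type*} [NormedAddCommGroup V] {F : Submodule ℂ E}
    {T : Set (Submodule ℂ E)} (hT : T.Finite) (h : ∀ Y ∈ T, ¬ F ≤ Y) {U : Set E} (hU : IsOpen U)
    {φ ψ : E → V} (hφ : ContinuousOn φ U) (hψ : ContinuousOn ψ U)
    (he : ∀ x ∈ U, x ∈ F → x ∈ off T → φ x = ψ x) {x : E} (hx : x ∈ U) (hxF : x ∈ F) :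
    φ x = ψ x := by
  have hcl : x ∈ closure (U ∩ (F ∩ off T)) :=
    hU.inter_closure ⟨hx, subset_closure_inter_off hT h hxF⟩
  have hc : ContinuousWithinAt (fun y => φ y - ψ y) (U ∩ (F ∩ off T)) x :=
    ((hφ.sub hψ) x hx).mono Set.inter_subset_left
  have := hc.mem_closure hcl (t := {0}) fun y hy => by
    simp [he y hy.1 hy.2.1 hy.2.2]
  rw [closure_singleton, Set.mem_singleton_iff] at this
  exact sub_eq_zero.mp this

theorem eq_of_eq_on_complement {V : Type*} [NormedAddCommGroup V] (B : CentralArrangement E)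
    {U : Set E} (hU : IsOpen U) {φ ψ : E → V} (hφ : ContinuousOn φ U) (hψ : ContinuousOn ψ U)
    (he : ∀ x ∈ U, x ∈ B.complement → φ x = ψ x) {x : E} (hx : x ∈ U) : φ x = ψ x :=
  eq_of_eq_on_off (F := ⊤) B.finite (fun Y hY hle => (B.isCoatom Y hY).1 (top_le_iff.mp hle)) hU
    hφ hψ (fun y hy _ hyT => he y hy hyT) hx trivial

end Equations

end LogForms

namespace LogForms

namespace CentralArrangement

/-! ### Operations on the weight filtration -/

section Operations

variable {E : Type u} [NormedAddCommGroup E] [NormedSpace ℂ E]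

theorem covector_smul_zero {p : ℕ} (c : ℂ) : c • (0 : E [⋀^Fin p]→L[ℂ] ℂ) = 0 := by
  ext v; simp

theorem covector_zero_smul {p : ℕ} (w : E [⋀^Fin p]→L[ℂ] ℂ) : (0 : ℂ) • w = 0 := by
  ext v; simp

/-- Multiplication of forms by a function. -/
noncomputable def mulForm (g : E → ℂ) {p : ℕ} : Form E p →ₗ[ℂ] Form E p where
  toFun ω := fun x => g x • ω x
  map_add' _ _ := funext fun _ => smul_add _ _ _
  map_smul' c ω := funext fun x => smul_comm (g x) c (ω x)

theorem mulForm_apply (g : E → ℂ) {p : ℕ} (ω : Form E p) (x : E) :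
    mulForm g ω x = g x • ω x := rfl

/-- The exterior product `ω ↦ ω ∧ θ` with a constant `1`-form. -/
noncomputable def wedgeConst (θ : E →L[ℂ] ℂ) {p : ℕ} : Form E p →ₗ[ℂ] Form E (p + 1) where
  toFun ω := fun x => wedge (ω x) θ
  map_add' _ _ := funext fun _ => wedge_add _ _ _
  map_smul' _ _ := funext fun _ => wedge_smul _ _ _

theorem wedgeConst_apply (θ : E →L[ℂ] ℂ) {p : ℕ} (ω : Form E p) (x : E) :
    wedgeConst θ ω x = wedge (ω x) θ := rfl

theorem mulForm_cut (U : Set E) (g : E → ℂ) {p : ℕ} (ω : Form E p) :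
    mulForm g (cut U ω) = cut U (mulForm g ω) := by
  refine Form.ext fun x => ?_
  rw [mulForm_apply]
  by_cases hx : x ∈ U
  · rw [cut_of_mem _ hx, cut_of_mem _ hx, mulForm_apply]
  · rw [cut_of_notMem _ hx, cut_of_notMem _ hx, covector_smul_zero]

theorem wedgeConst_cut (U : Set E) (θ : E →L[ℂ] ℂ) {p : ℕ} (ω : Form E p) :
    wedgeConst θ (cut U ω) = cut U (wedgeConst θ ω) := by
  refine Form.ext fun x => ?_
  rw [wedgeConst_apply]
  by_cases hx : x ∈ U
  · rw [cut_of_mem _ hx, cut_of_mem _ hx, wedgeConst_apply]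
  · rw [cut_of_notMem _ hx, cut_of_notMem _ hx, wedge_zero_left]

theorem mulForm_wedgeLog (X : Submodule ℂ E) (g : E → ℂ) {p : ℕ} (ω : Form E p) :
    mulForm g (wedgeLog X ω) = wedgeLog X (mulForm g ω) :=
  Form.ext fun _ => (wedge_smul _ _ _).symm

theorem wedgeConst_wedgeLog (X : Submodule ℂ E) (θ : E →L[ℂ] ℂ) {p : ℕ} (ω : Form E p) :
    wedgeConst θ (wedgeLog X ω) = wedgeLog X (-wedgeConst θ ω) := by
  rw [map_neg]
  exact Form.ext fun x => wedge_wedge_comm _ _ _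

theorem wedgeLog_comm (X Y : Submodule ℂ E) {p : ℕ} (ω : Form E p) :
    wedgeLog X (wedgeLog Y ω) = -wedgeLog Y (wedgeLog X ω) :=
  Form.ext fun _ => wedge_wedge_comm _ _ _

theorem wedgeLog_self (X : Submodule ℂ E) {p : ℕ} (ω : Form E p) :
    wedgeLog X (wedgeLog X ω) = 0 :=
  Form.ext fun _ => wedge_wedge_self _ _

theorem IsLogMonomial.subset {B : CentralArrangement E} {I : Finset (Submodule ℂ E)} {p : ℕ}
    {ω : Form E p} (h : B.IsLogMonomial I p ω) : ∀ X ∈ I, X ∈ B.hyperplanes := by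
  induction h with
  | holomorphic => simp
  | wedge hX hXI h ih =>
    intro Y hY
    rcases Finset.mem_cons.mp hY with rfl | hY
    · exact hX
    · exact ih Y hY

theorem IsLogMonomial.mulForm {B : CentralArrangement E} {g : E → ℂ}
    (hg : AnalyticOnNhd ℂ g Set.univ) {I : Finset (Submodule ℂ E)} {p : ℕ}
    {ω : Form E p} (h : B.IsLogMonomial I p ω) :
    B.IsLogMonomial I p (CentralArrangement.mulForm g ω) := by
  induction h with
  | holomorphic η hη =>
    rw [mulForm_cut]
    exact .holomorphic _ ⟨fun x hx => (hg x hx).smul (hη.1 x hx), fun x hx => absurd trivial hx⟩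
  | wedge hX hXI h ih => rw [mulForm_wedgeLog]; exact .wedge hX hXI ih

theorem mulForm_mem_weight {B : CentralArrangement E} {g : E → ℂ}
    (hg : AnalyticOnNhd ℂ g Set.univ) {k : ℤ} {p : ℕ} {ω : Form E p} (h : ω ∈ B.weight k p) :
    mulForm g ω ∈ B.weight k p := by
  revert ω
  change B.weight k p ≤ (B.weight k p).comap (mulForm g)
  exact weight_induction fun I ω hI hω => (hω.mulForm hg).mem_weight hI

theorem wedgeConst_mem_weight {B : CentralArrangement E} (θ : E →L[ℂ] ℂ) {k : ℤ} {p : ℕ}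
    {ω : Form E p} (h : ω ∈ B.weight k p) : wedgeConst θ ω ∈ B.weight k (p + 1) := by
  revert ω
  change B.weight k p ≤ (B.weight k (p + 1)).comap (wedgeConst θ)
  refine weight_induction fun I ω hI hω => weight_mono _ hI _ ?_
  clear hI
  induction hω with
  | @holomorphic p η hη =>
    rw [wedgeConst_cut]
    have hθ : wedgeConst θ η ∈ holForms Set.univ (p + 1) :=
      ⟨fun x hx => analyticAt_wedge (hη.1 x hx) analyticAt_const, fun x hx => absurd trivial hx⟩
    exact (IsLogMonomial.holomorphic _ hθ).mem_weight (by simp)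
  | wedge hX hXI h ih =>
    rw [wedgeConst_wedgeLog, Finset.card_cons, Nat.cast_succ]
    exact wedgeLog_mem_weight hX (neg_mem ih)

/-- A monomial without the factor `ω_H` comes from the deletion of `H`. -/
theorem IsLogMonomial.exists_deletion {B : CentralArrangement E} {H : Submodule ℂ E}
    {I : Finset (Submodule ℂ E)} {p : ℕ} {ω : Form E p} (h : B.IsLogMonomial I p ω) (hI : H ∉ I) :
    ∃ ω', (B.deletion H).IsLogMonomial I p ω' ∧ cut B.complement ω' = ω := by
  induction h with
  | holomorphic η hη =>
    exact ⟨_, .holomorphic η hη, cut_cut (B.complement_subset_deletion H) _⟩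
  | @wedge I p ω X hX hXI h ih =>
    rw [Finset.mem_cons, not_or] at hI
    obtain ⟨ω', hω', rfl⟩ := ih hI.2
    have hX' : X ∈ (B.deletion H).hyperplanes := ⟨hX, Ne.symm hI.1⟩
    exact ⟨wedgeLog X ω', .wedge hX' hXI hω', (wedgeLog_cut _ _ _).symm⟩

variable [FiniteDimensional ℂ E]

theorem mulForm_equation_wedgeLog {B : CentralArrangement E} {H : Submodule ℂ E}
    (hH : H ∈ B.hyperplanes) {p : ℕ} {α : Form E p} (hα : α ∈ holForms (B.deletion H).complement p) :
    mulForm (fun x => equation H x) (wedgeLog H α) =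
      cut B.complement (wedgeConst (equation H) α) := by
  have hc := B.isCoatom H hH
  refine Form.ext fun x => ?_
  rw [mulForm_apply, wedgeLog_apply]
  by_cases hx : x ∈ B.complement
  · have h0 : equation H x ≠ 0 := fun h => hx H hH ((equation_eq_zero hc).1 h)
    rw [cut_of_mem _ hx, wedgeConst_apply, logForm_eq_equation hc, wedge_smul_right, smul_smul,
      mul_inv_cancel₀ h0, one_smul]
  · rw [cut_of_notMem _ hx]
    by_cases hxH : x ∈ H
    · rw [logForm_of_mem hc hxH, wedge_zero_right, covector_smul_zero]
    · rw [holForms_zero hα fun h => hx (mem_complement_of_deletion h hxH), wedge_zero_left, covector_smul_zero]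

/-- Multiplication by an equation of `H` removes the pole along `H`. -/
theorem mulForm_equation_mem {B : CentralArrangement E} {H : Submodule ℂ E}
    (hH : H ∈ B.hyperplanes) {k : ℤ} {p : ℕ} {ω : Form E p} (h : ω ∈ B.weight k p) :
    mulForm (fun x => equation H x) ω ∈ ((B.deletion H).weight k p).map (cut B.complement) := by
  have ha : AnalyticOnNhd ℂ (fun x => equation H x) Set.univ := fun x _ => analyticAt_equation H x
  cases p with
  | zero =>
    obtain ⟨β, hβ, rfl⟩ := weight_decomp_zero hH h
    exact ⟨_, mulForm_mem_weight ha hβ, (mulForm_cut _ _ _).symm⟩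
  | succ p =>
    obtain ⟨α, hα, β, hβ, rfl⟩ := weight_decomp_succ hH h
    rw [map_add, mulForm_equation_wedgeLog hH (weight_le_holForms _ _ _ hα), mulForm_cut, ← map_add]
    exact ⟨_, add_mem (weight_mono _ (by omega) _ (wedgeConst_mem_weight _ hα))
      (mulForm_mem_weight ha hβ), rfl⟩

/-! ### Clearing denominators -/

theorem eqProd_insert [DecidableEq (Submodule ℂ E)] (S : Finset (Submodule ℂ E))
    {X : Submodule ℂ E} (h : X ∉ S) (x : E) :
    eqProd (insert X S) x = equation X x * eqProd S x := Finset.prod_insert h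

/-- After multiplication by the equations of the members of `S`, the monomial `η ∧ ω_I` extends
across the members of `S`. -/
theorem IsLogMonomial.exists_extension {B : CentralArrangement E} {I : Finset (Submodule ℂ E)}
    {p : ℕ} {ω : Form E p} (h : B.IsLogMonomial I p ω) (S : Finset (Submodule ℂ E)) :
    ∃ φ : E → E [⋀^Fin p]→L[ℂ] ℂ, AnalyticOnNhd ℂ φ (off ((I : Set (Submodule ℂ E)) \ S)) ∧
      ∀ x ∈ B.complement, φ x = eqProd S x • ω x := by
  classical
  induction h generalizing S with
  | holomorphic η hη =>
    refine ⟨fun x => eqProd S x • η x, fun x _ => (analyticAt_eqProd S x).smul (hη.1 x trivial),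
      fun x hx => ?_⟩
    rw [cut_of_mem _ hx]
  | @wedge I p ω X hX hXI h ih =>
    have hc := B.isCoatom X hX
    by_cases hXS : X ∈ S
    · obtain ⟨φ, hφ, he⟩ := ih (S.erase X)
      refine ⟨fun x => LogForms.wedge (φ x) (equation X), fun x hx =>
        analyticAt_wedge (hφ x (off_anti ?_ hx)) analyticAt_const, fun x hx => ?_⟩
      · rintro Y ⟨hYI, hYS⟩
        refine ⟨by simp [Finset.mem_coe.mp hYI], fun hY => hYS ?_⟩
        exact Finset.mem_erase.mpr ⟨fun h => hXI (h ▸ hYI), hY⟩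
      · have h0 : equation X x ≠ 0 := fun h => hx X hX ((equation_eq_zero hc).1 h)
        have e1 : eqProd S x = equation X x * eqProd (S.erase X) x :=
          (Finset.mul_prod_erase S (fun Y => equation Y x) hXS).symm
        change LogForms.wedge (φ x) (equation X) = eqProd S x • LogForms.wedge (ω x) (logForm X x)
        rw [he x hx, logForm_eq_equation hc, wedge_smul, wedge_smul_right, smul_smul, e1,
          mul_right_comm, mul_inv_cancel₀ h0, one_mul]
    · obtain ⟨φ, hφ, he⟩ := ih S
      refine ⟨fun x => LogForms.wedge (φ x) (logForm X x), fun x hx =>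
        analyticAt_wedge (hφ x (off_anti ?_ hx)) (analyticAt_logForm hc (hx X ⟨by simp, hXS⟩)),
        fun x hx => ?_⟩
      · rintro Y ⟨hYI, hYS⟩
        exact ⟨by simp [Finset.mem_coe.mp hYI], hYS⟩
      · change LogForms.wedge (φ x) (logForm X x) = eqProd S x • LogForms.wedge (ω x) (logForm X x)
        rw [he x hx, wedge_smul]

theorem exists_extension {B : CentralArrangement E} (S : Finset (Submodule ℂ E)) {k : ℤ} {p : ℕ}
    {ω : Form E p} (h : ω ∈ B.weight k p) :
    ∃ φ : E → E [⋀^Fin p]→L[ℂ] ℂ, AnalyticOnNhd ℂ φ (off (B.hyperplanes \ S)) ∧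
      ∀ x ∈ B.complement, φ x = eqProd S x • ω x := by
  induction h using Submodule.span_induction with
  | mem ω h =>
    obtain ⟨I, -, hω⟩ := h
    obtain ⟨φ, hφ, he⟩ := hω.exists_extension S
    exact ⟨φ, hφ.mono (off_anti (Set.sdiff_subset_sdiff_left fun X hX => hω.subset X hX)), he⟩
  | zero =>
    exact ⟨fun _ => 0, fun _ _ => analyticAt_const, fun x _ => (covector_smul_zero _).symm⟩
  | add a b _ _ ha hb =>
    obtain ⟨φ, hφ, hφe⟩ := ha
    obtain ⟨ψ, hψ, hψe⟩ := hb
    refine ⟨fun x => φ x + ψ x, fun x hx => (hφ x hx).add (hψ x hx), fun x hx => ?_⟩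
    change φ x + ψ x = eqProd S x • (a x + b x)
    rw [hφe x hx, hψe x hx, smul_add]
  | smul c a _ ha =>
    obtain ⟨φ, hφ, hφe⟩ := ha
    refine ⟨fun x => c • φ x, fun x hx => (analyticAt_const (v := c)).smul (hφ x hx), fun x hx => ?_⟩
    change c • φ x = eqProd S x • (c • a x)
    rw [hφe x hx, smul_comm]

/-- The forms `ω` on the complement of `B` such that `∏_{H ∈ S} f_H • ω` extends continuously across
the members of `S`, by a form that vanishes on the intersection of all of them. -/
def vanishing (B : CentralArrangement E) (S : Finset (Submodule ℂ E)) (p : ℕ) :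
    Submodule ℂ (Form E p) where
  carrier := {ω | ∃ φ : E → E [⋀^Fin p]→L[ℂ] ℂ, ContinuousOn φ (off (B.hyperplanes \ S)) ∧
      (∀ x ∈ B.complement, φ x = eqProd S x • ω x) ∧
      ∀ x ∈ off (B.hyperplanes \ S), (∀ H ∈ S, x ∈ H) → φ x = 0}
  add_mem' := by
    rintro a b ⟨φ, hφ, hφe, hφ0⟩ ⟨ψ, hψ, hψe, hψ0⟩
    refine ⟨fun x => φ x + ψ x, hφ.add hψ, fun x hx => ?_, fun x hx hxS => ?_⟩
    · change φ x + ψ x = eqProd S x • (a x + b x)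
      rw [hφe x hx, hψe x hx, smul_add]
    · simp only [hφ0 x hx hxS, hψ0 x hx hxS, add_zero]
  zero_mem' := ⟨fun _ => 0, continuousOn_const, fun x _ => (covector_smul_zero _).symm,
    fun _ _ _ => rfl⟩
  smul_mem' := by
    rintro c a ⟨φ, hφ, hφe, hφ0⟩
    refine ⟨fun x => c • φ x, hφ.const_smul c, fun x hx => ?_, fun x hx hxS => ?_⟩
    · change c • φ x = eqProd S x • (c • a x)
      rw [hφe x hx, smul_comm]
    · simp only [hφ0 x hx hxS, covector_smul_zero]

theorem eq_zero_of_mem_vanishing {B : CentralArrangement E} {S : Finset (Submodule ℂ E)} {p : ℕ}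
    {ω : Form E p} (h : ω ∈ B.vanishing S p) {φ : E → E [⋀^Fin p]→L[ℂ] ℂ}
    (hφ : ContinuousOn φ (off (B.hyperplanes \ S)))
    (he : ∀ x ∈ B.complement, φ x = eqProd S x • ω x) {x : E} (hx : x ∈ off (B.hyperplanes \ S))
    (hxS : ∀ H ∈ S, x ∈ H) : φ x = 0 := by
  obtain ⟨ψ, hψ, hψe, hψ0⟩ := h
  rw [← hψ0 x hx hxS]
  exact eq_of_eq_on_complement B (isOpen_off (B.finite.subset Set.sdiff_subset)) hφ hψ
    (fun y _ hy => (he y hy).trans (hψe y hy).symm) hx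

/-! ### Forms without pole along some member of a set of hyperplanes -/

/-- The sum over `H ∈ S` of the spaces of forms of weight at most `k` without pole along `H`. -/
noncomputable def regularPart (B : CentralArrangement E) (S : Finset (Submodule ℂ E)) (k : ℤ)
    (p : ℕ) : Submodule ℂ (Form E p) :=
  ⨆ H ∈ S, ((B.deletion H).weight k p).map (cut B.complement)

theorem map_cut_le_regularPart (B : CentralArrangement E) {S : Finset (Submodule ℂ E)}
    {H : Submodule ℂ E}
    (hH : H ∈ S) (k : ℤ) (p : ℕ) :
    ((B.deletion H).weight k p).map (cut B.complement) ≤ B.regularPart S k p :=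
  le_iSup₂_of_le H hH le_rfl

theorem regularPart_mono (B : CentralArrangement E) {S T : Finset (Submodule ℂ E)} (h : S ⊆ T)
    (k : ℤ) (p : ℕ) : B.regularPart S k p ≤ B.regularPart T k p :=
  iSup₂_le fun _ hH => B.map_cut_le_regularPart (h hH) k p

theorem wedgeLog_mem_regularPart {B : CentralArrangement E} {S : Finset (Submodule ℂ E)}
    {Y : Submodule ℂ E} (hY : Y ∈ B.hyperplanes) (hYS : Y ∉ S) {k : ℤ} {p : ℕ} {τ : Form E p}
    (h : τ ∈ B.regularPart S k p) : wedgeLog Y τ ∈ B.regularPart S (k + 1) (p + 1) := by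
  revert τ
  change B.regularPart S k p ≤ (B.regularPart S (k + 1) (p + 1)).comap (wedgeLog Y)
  refine iSup₂_le fun H hH => ?_
  rintro _ ⟨τ, hτ, rfl⟩
  refine B.map_cut_le_regularPart hH _ _ ⟨wedgeLog Y τ, ?_, (wedgeLog_cut _ _ _).symm⟩
  exact wedgeLog_mem_weight (A := B.deletion H) ⟨hY, fun h => hYS (h ▸ hH)⟩ hτ

theorem deletion_comm (B : CentralArrangement E) (X H : Submodule ℂ E) :
    (B.deletion X).deletion H = (B.deletion H).deletion X := by
  have h : (B.hyperplanes \ {X}) \ {H} = (B.hyperplanes \ {H}) \ {X} := Set.sdiff_sdiff_comm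
  simp only [deletion, h]

theorem cut_mem_regularPart {B : CentralArrangement E} {S : Finset (Submodule ℂ E)}
    (X : Submodule ℂ E) {k : ℤ} {p : ℕ} {τ : Form E p}
    (h : τ ∈ (B.deletion X).regularPart S k p) : cut B.complement τ ∈ B.regularPart S k p := by
  revert τ
  change (B.deletion X).regularPart S k p ≤ (B.regularPart S k p).comap (cut B.complement)
  refine iSup₂_le fun H hH => ?_
  rintro _ ⟨τ, hτ, rfl⟩
  rw [deletion_comm] at hτ
  refine B.map_cut_le_regularPart hH _ _ ⟨_, cut_mem_weight X hτ, ?_⟩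
  rw [cut_cut (B.complement_subset_deletion H), cut_cut (B.complement_subset_deletion X)]

theorem regularPart_le_vanishing (B : CentralArrangement E) {S : Finset (Submodule ℂ E)}
    (hS : ∀ H ∈ S, H ∈ B.hyperplanes) (k : ℤ) (p : ℕ) :
    B.regularPart S k p ≤ B.vanishing S p := by
  classical
  refine iSup₂_le fun H hH => ?_
  rintro _ ⟨τ, hτ, rfl⟩
  obtain ⟨φ, hφ, he⟩ := exists_extension (S.erase H) hτ
  have hoff : off (B.hyperplanes \ S) ⊆ off ((B.deletion H).hyperplanes \ (S.erase H : Finset _)) := by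
    refine off_anti ?_
    rintro Y ⟨⟨hYB, hYH⟩, hYS⟩
    exact ⟨hYB, fun hY => hYS (Finset.mem_erase.mpr ⟨hYH, hY⟩)⟩
  refine ⟨fun x => equation H x • φ x,
    (equation H).continuous.continuousOn.smul (hφ.continuousOn.mono hoff), fun x hx => ?_,
    fun x _ hxS => ?_⟩
  · have e1 : eqProd S x = equation H x * eqProd (S.erase H) x :=
      (Finset.mul_prod_erase S (fun Y => equation Y x) hH).symm
    change equation H x • φ x = _
    rw [he x (B.complement_subset_deletion H hx), cut_of_mem _ hx, smul_smul, e1]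
  · have h0 : equation H x = 0 := (equation_eq_zero (B.isCoatom H (hS H hH))).2 (hxS H hH)
    simp only [h0, covector_zero_smul]

end Operations

end CentralArrangement

end LogForms

namespace LogForms

namespace CentralArrangement

section Relations

variable {E : Type u} [NormedAddCommGroup E] [NormedSpace ℂ E] [FiniteDimensional ℂ E]

/-! ### Relations between logarithmic monomials -/

theorem wedgeLog_cut_deletion {B : CentralArrangement E} {H : Submodule ℂ E}
    (hH : H ∈ B.hyperplanes) {p : ℕ} {α : Form E p} (hα : α ∈ holForms (B.deletion H).complement p) :
    wedgeLog H (cut B.complement α) = wedgeLog H α := by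
  refine Form.ext fun x => ?_
  rw [wedgeLog_apply, wedgeLog_apply]
  by_cases hx : x ∈ B.complement
  · rw [cut_of_mem _ hx]
  · by_cases hxH : x ∈ H
    · rw [logForm_of_mem (B.isCoatom H hH) hxH, wedge_zero_right, wedge_zero_right]
    · rw [cut_of_notMem _ hx, holForms_zero hα fun h => hx (mem_complement_of_deletion h hxH)]

/-- Modulo forms without pole along some member of `T`, every logarithmic form is divisible by all
the `ω_H - ω_X`, `H ∈ T`, and hence killed by them. -/
theorem exists_add_wedgeLog_eq {B : CentralArrangement E} {X : Submodule ℂ E}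
    (hX : X ∈ B.hyperplanes) (T : Finset (Submodule ℂ E)) (hT : ∀ H ∈ T, H ∈ B.hyperplanes)
    (hXT : X ∉ T) {k : ℤ} {p : ℕ} {ω : Form E p} (h : ω ∈ B.weight k p) :
    ∃ g ∈ B.regularPart T k p, ∃ κ ∈ B.weight k p,
      (∀ H ∈ T, wedgeLog H κ = wedgeLog X κ) ∧ ω = g + κ := by
  classical
  induction T using Finset.induction_on generalizing k p with
  | empty => exact ⟨0, zero_mem _, ω, h, by simp, (zero_add _).symm⟩
  | insert H T hHT ih =>
    have hHB := hT H (Finset.mem_insert_self H T)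
    rw [Finset.mem_insert, not_or] at hXT
    cases p with
    | zero =>
      obtain ⟨β, hβ, rfl⟩ := weight_decomp_zero hHB h
      exact ⟨_, B.map_cut_le_regularPart (Finset.mem_insert_self H T) _ _ ⟨β, hβ, rfl⟩, 0,
        zero_mem _, fun K _ => by rw [map_zero, map_zero], (add_zero _).symm⟩
    | succ p =>
      obtain ⟨α, hα, β, hβ, rfl⟩ := weight_decomp_succ hHB h
      obtain ⟨g, hg, κ, hκ, hκT, e⟩ := ih (fun K hK => hT K (Finset.mem_insert_of_mem hK)) hXT.2
        (cut_mem_weight H hα)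
      have hk : ∀ {q : ℕ} {τ : Form E q}, τ ∈ B.regularPart T (k - 1 + 1) q →
          τ ∈ B.regularPart (insert H T) k q := fun {q τ} hτ =>
        B.regularPart_mono (Finset.subset_insert H T) k q (by simpa using hτ)
      have hXα : wedgeLog X (cut B.complement α) ∈ B.regularPart (insert H T) k (p + 1) := by
        refine B.map_cut_le_regularPart (Finset.mem_insert_self H T) _ _
          ⟨wedgeLog X α, ?_, (wedgeLog_cut _ _ _).symm⟩
        have := wedgeLog_mem_weight (A := B.deletion H) (X := X) ⟨hX, hXT.1⟩ hα
        rwa [sub_add_cancel] at this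
      -- With `α = g + κ` on the complement, replace `κ ∧ ω_H` by `κ ∧ (ω_H - ω_X)`; the other terms
      -- of `α ∧ ω_H` have no pole along `H` or along some member of `T`.
      refine ⟨wedgeLog H g - wedgeLog X g + wedgeLog X (cut B.complement α) + cut B.complement β,
        add_mem (add_mem (sub_mem (hk (wedgeLog_mem_regularPart hHB hHT hg))
          (hk (wedgeLog_mem_regularPart hX hXT.2 hg))) hXα)
          (B.map_cut_le_regularPart (Finset.mem_insert_self H T) _ _ ⟨β, hβ, rfl⟩),
        wedgeLog H κ - wedgeLog X κ, ?_, fun K hK => ?_, ?_⟩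
      · have h1 := sub_mem (wedgeLog_mem_weight hHB hκ) (wedgeLog_mem_weight hX hκ)
        rwa [sub_add_cancel] at h1
      · rw [map_sub, map_sub, wedgeLog_self X, sub_zero]
        rcases Finset.mem_insert.mp hK with rfl | hK
        · rw [wedgeLog_self, zero_sub, wedgeLog_comm K X, neg_neg]
        · rw [wedgeLog_comm K H, wedgeLog_comm K X, hκT K hK, wedgeLog_self, neg_zero, sub_zero,
            wedgeLog_comm H X, neg_neg]
      · rw [← wedgeLog_cut_deletion hHB (weight_le_holForms _ _ _ hα), e, map_add, map_add]
        abel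

theorem exists_equation_eq_sum {T : Finset (Submodule ℂ E)} (hT : ∀ H ∈ T, IsCoatom H)
    {Y : Submodule ℂ E} (hY : IsCoatom Y) (h : T.inf id ≤ Y) :
    ∃ c : T → ℂ, ∑ H : T, c H • equation (H : Submodule ℂ E) = equation Y := by
  have hle : ⨅ H : T, LinearMap.ker (equation (H : Submodule ℂ E)).toLinearMap ≤
      LinearMap.ker (equation Y).toLinearMap := by
    rw [ker_equation hY]
    refine le_trans (fun x hx => ?_) h
    rw [Submodule.mem_finsetInf]
    intro H hH
    have := (Submodule.mem_iInf _).mp hx ⟨H, hH⟩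
    rwa [ker_equation (hT H hH)] at this
  obtain ⟨c, hc⟩ := (Submodule.mem_span_range_iff_exists_fun ℂ).mp (mem_span_of_iInf_ker_le_ker hle)
  refine ⟨c, ?_⟩
  ext v
  have := congrArg (fun g => g v) hc
  simpa using this

/-- If `κ ∧ ω_H` is the same form for all `H ∈ T`, then it is also `κ ∧ ω_Y` for each `Y` that
contains the intersection of `T`, because `ω_Y` is a combination of the `ω_H` with coefficients
of sum one. -/
theorem wedge_logForm_eq {T : Finset (Submodule ℂ E)} (hT : ∀ H ∈ T, IsCoatom H)
    {Y : Submodule ℂ E} (hY : IsCoatom Y) (h : T.inf id ≤ Y) {x : E}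
    (hx : x ∈ off (T : Set (Submodule ℂ E))) (hxY : x ∉ Y) {p : ℕ} {w : E [⋀^Fin p]→L[ℂ] ℂ}
    {θ : E [⋀^Fin (p + 1)]→L[ℂ] ℂ} (hw : ∀ H ∈ T, wedge w (logForm H x) = θ) :
    wedge w (logForm Y x) = θ := by
  obtain ⟨c, hc⟩ := exists_equation_eq_sum hT hY h
  have hw' : ∀ H : T, wedge w (equation (H : Submodule ℂ E)) = equation (H : Submodule ℂ E) x • θ := by
    intro H
    have h0 : equation (H : Submodule ℂ E) x ≠ 0 :=
      fun h => hx H H.2 ((equation_eq_zero (hT H H.2)).1 h)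
    rw [← hw H H.2, logForm_eq_equation (hT H H.2), wedge_smul_right, smul_smul, mul_inv_cancel₀ h0,
      one_smul]
  have hY0 : equation Y x ≠ 0 := fun h => hxY ((equation_eq_zero hY).1 h)
  have hcx : ∑ H : T, c H * equation (H : Submodule ℂ E) x = equation Y x := by
    rw [← hc]; simp
  rw [logForm_eq_equation hY, wedge_smul_right, inv_smul_eq_iff₀ hY0, ← hcx]
  conv_lhs => rw [← hc, wedge_sum_right]
  simp only [wedge_smul_right, hw', smul_smul]
  ext v
  simp [ContinuousAlternatingMap.sum_apply, Finset.sum_mul]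

/-- The relation of Arnold and Orlik–Solomon: if the member `Y` contains the intersection of `X` and
of the members of `S`, then `τ ∧ (ω_Y - ω_X)` is a sum of forms without pole along some member
of `S`. -/
theorem wedgeLog_sub_mem_regularPart {B : CentralArrangement E} {S : Finset (Submodule ℂ E)}
    (hS : ∀ H ∈ S, H ∈ B.hyperplanes) {X Y : Submodule ℂ E} (hX : X ∈ B.hyperplanes) (hXS : X ∉ S)
    (hY : Y ∈ B.hyperplanes) (hYS : Y ∉ S) (h : S.inf id ⊓ X ≤ Y) {k : ℤ} {p : ℕ} {τ : Form E p}
    (hτ : τ ∈ B.weight k p) :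
    wedgeLog Y τ - wedgeLog X τ ∈ B.regularPart S (k + 1) (p + 1) := by
  classical
  obtain ⟨g, hg, κ, hκ, hκS, rfl⟩ := exists_add_wedgeLog_eq hX S hS hXS hτ
  have hκ0 : wedgeLog Y κ = wedgeLog X κ := by
    refine Form.ext fun x => ?_
    rw [wedgeLog_apply, wedgeLog_apply]
    by_cases hx : x ∈ B.complement
    · have hB : ∀ H ∈ insert X S, H ∈ B.hyperplanes := fun H hH =>
        (Finset.mem_insert.mp hH).elim (fun h => h ▸ hX) (hS H)
      refine wedge_logForm_eq (T := insert X S) (fun H hH => B.isCoatom H (hB H hH))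
        (B.isCoatom Y hY) ?_ (fun H hH => hx H (hB H hH)) (hx Y hY) fun H hH => ?_
      · rw [Finset.inf_insert, inf_comm]; exact h
      · rcases Finset.mem_insert.mp hH with rfl | hH
        · rfl
        · exact congrFun (hκS H hH) x
    · rw [holForms_zero (weight_le_holForms _ _ _ hκ) hx, wedge_zero_left, wedge_zero_left]
  rw [map_add, map_add, hκ0, add_sub_add_right_eq_sub]
  exact sub_mem (wedgeLog_mem_regularPart hY hYS hg) (wedgeLog_mem_regularPart hX hXS hg)

/-! ### Independent hyperplanes -/

/-- A set of hyperplanes is independent if their equations are linearly independent, in the form that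
each equation takes a non-zero value at some common zero of the others. -/
def Independent (S : Finset (Submodule ℂ E)) : Prop :=
  ∀ H ∈ S, ∃ e, e ∉ H ∧ ∀ K ∈ S, K ≠ H → e ∈ K

theorem Independent.subset {S T : Finset (Submodule ℂ E)} (h : Independent S) (hT : T ⊆ S) :
    Independent T := fun H hH =>
  let ⟨e, he, heK⟩ := h H (hT hH)
  ⟨e, he, fun K hK => heK K (hT hK)⟩

theorem Independent.exists_dual {S : Finset (Submodule ℂ E)} (h : Independent S)
    (hS : ∀ H ∈ S, IsCoatom H) {H : Submodule ℂ E} (hH : H ∈ S) :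
    ∃ e, equation H e = 1 ∧ ∀ K ∈ S, K ≠ H → e ∈ K := by
  obtain ⟨e, he, heK⟩ := h H hH
  have h0 : equation H e ≠ 0 := fun h => he ((equation_eq_zero (hS H hH)).1 h)
  exact ⟨(equation H e)⁻¹ • e, by simp [h0], fun K hK hKH => K.smul_mem _ (heK K hK hKH)⟩

theorem Independent.insert [DecidableEq (Submodule ℂ E)] {S : Finset (Submodule ℂ E)}
    (h : Independent S) {X : Submodule ℂ E} (hX : IsCoatom X) (hXS : ¬ S.inf id ≤ X) :
    Independent (insert X S) := by
  obtain ⟨e, heS, heX⟩ := Set.not_subset.mp hXS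
  have heS' : ∀ K ∈ S, e ∈ K := fun K hK => Submodule.mem_finsetInf.mp heS K hK
  have h0 : equation X e ≠ 0 := fun h => heX ((equation_eq_zero hX).1 h)
  intro H hH
  rcases Finset.mem_insert.mp hH with rfl | hH
  · exact ⟨e, heX, fun K hK hKH => heS' K ((Finset.mem_insert.mp hK).resolve_left hKH)⟩
  · obtain ⟨v, hv, hvK⟩ := h H hH
    refine ⟨v - (equation X v / equation X e) • e, fun hmem => hv ?_, fun K hK hKH => ?_⟩
    · have := H.add_mem hmem (H.smul_mem (equation X v / equation X e) (heS' H hH))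
      rwa [sub_add_cancel] at this
    · rcases Finset.mem_insert.mp hK with rfl | hK
      · rw [← equation_eq_zero hX]; simp [h0]
      · exact K.sub_mem (hvK K hK hKH) (K.smul_mem _ (heS' K hK))

/-- The entire `p`-forms killed by the exterior product with the equations of the members of `S`.
For independent `S`, these are the forms `η ∧ df_{H₁} ∧ ⋯ ∧ df_{H_r}`. -/
noncomputable def killedForms (S : Finset (Submodule ℂ E)) (p : ℕ) : Submodule ℂ (Form E p) :=
  holForms Set.univ p ⊓ ⨅ H ∈ S, LinearMap.ker (wedgeConst (equation H))

theorem mem_killedForms {S : Finset (Submodule ℂ E)} {p : ℕ} {φ : Form E p} :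
    φ ∈ killedForms S p ↔ AnalyticOnNhd ℂ (φ : E → E [⋀^Fin p]→L[ℂ] ℂ) Set.univ ∧
      ∀ H ∈ S, ∀ x, wedge (φ x) (equation H) = 0 := by
  rw [killedForms, Submodule.mem_inf]
  refine and_congr ⟨fun h => h.1, fun h => ⟨h, fun x hx => absurd trivial hx⟩⟩ ?_
  simp only [Submodule.mem_iInf, LinearMap.mem_ker]
  exact ⟨fun h H hH x => congrFun (h H hH) x, fun h H hH => Form.ext (h H hH)⟩

/-- Koszul-type division: a killed form that vanishes on the intersection of the members of `T` is a
combination of the equations of these members, with killed forms as coefficients. -/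
theorem mem_iSup_mulForm_of_eq_zero {S T : Finset (Submodule ℂ E)} (hS : ∀ H ∈ S, IsCoatom H)
    (hind : Independent S) (hTS : T ⊆ S) {p : ℕ} {φ : Form E p} (hφ : φ ∈ killedForms S p)
    (h0 : ∀ x, (∀ H ∈ T, x ∈ H) → φ x = 0) :
    φ ∈ ⨆ H ∈ T, (killedForms S p).map (mulForm fun x => equation H x) := by
  classical
  induction T using Finset.induction_on generalizing φ with
  | empty =>
    have : φ = 0 := Form.ext fun x => h0 x (by simp)
    rw [this]; exact zero_mem _
  | insert H T hHT ih =>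
    have hHS := hTS (Finset.mem_insert_self H T)
    obtain ⟨e, he, heK⟩ := hind.exists_dual hS hHS
    obtain ⟨hφa, hφk⟩ := mem_killedForms.mp hφ
    obtain ⟨m, hm, hmφ⟩ := exists_analyticOnNhd_sub_eq_smul hφa (equation H) he
    -- Evaluating the coefficients of `φ` at the projection of `x` to `H` along `e` changes `φ` by a
    -- multiple of the equation of `H`, and the new form vanishes where the equations of `T` do.
    let φ' : Form E p := fun x => φ (x - equation H x • e)
    have hφ' : φ' ∈ killedForms S p := by
      refine mem_killedForms.mpr ⟨fun x _ => ?_, fun K hK x => hφk K hK _⟩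
      exact AnalyticAt.fun_comp (g := (φ : E → E [⋀^Fin p]→L[ℂ] ℂ)) (hφa _ trivial)
        (analyticAt_id.sub ((analyticAt_equation H x).smul analyticAt_const))
    have hmk : (m : Form E p) ∈ killedForms S p := by
      refine mem_killedForms.mpr ⟨hm, fun K hK x => ?_⟩
      have hc : ContinuousOn (fun x => wedge (m x) (equation K)) Set.univ := fun x _ =>
        (analyticAt_wedge (hm x trivial) analyticAt_const).continuousAt.continuousWithinAt
      refine eq_of_eq_on_off (F := ⊤) (T := {H}) (Set.finite_singleton H)
        (by rintro Y rfl hle; exact (hS Y hHS).1 (top_le_iff.mp hle)) isOpen_univ hc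
        (ψ := fun _ => 0) continuousOn_const (fun y _ _ hy => ?_) (Set.mem_univ x) trivial
      have hy0 : equation H y ≠ 0 := fun h => hy H rfl ((equation_eq_zero (hS H hHS)).1 h)
      have h1 : equation H y • wedge (m y) (equation K) = 0 := by
        rw [← wedge_smul, ← hmφ y, sub_eq_add_neg, wedge_add, wedge_neg_left, hφk K hK, hφk K hK,
          neg_zero, add_zero]
      rw [← one_smul ℂ (wedge (m y) (equation K)), ← inv_mul_cancel₀ hy0, ← smul_smul, h1,
        covector_smul_zero]
    have hsplit : φ = φ' + mulForm (fun x => equation H x) (m : Form E p) := by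
      refine Form.ext fun x => ?_
      change φ x = φ (x - equation H x • e) + equation H x • m x
      rw [← hmφ x, add_sub_cancel]
    rw [hsplit]
    refine add_mem ?_ ?_
    · have h1 := ih (fun K hK => hTS (Finset.mem_insert_of_mem hK)) hφ' fun x hx => ?_
      · exact (biSup_mono (f := fun K => (killedForms S p).map (mulForm fun x => equation K x))
          fun K hK => Finset.mem_insert_of_mem hK) h1
      · refine h0 _ fun K hK => ?_
        rcases Finset.mem_insert.mp hK with rfl | hK
        · rw [← equation_eq_zero (hS K hHS)]; simp [he]
        · have hKH : K ≠ H := fun h => hHT (h ▸ hK)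
          exact K.sub_mem (hx K hK)
            (K.smul_mem _ (heK K (hTS (Finset.mem_insert_of_mem hK)) hKH))
    · exact le_iSup₂_of_le (f := fun K (_ : K ∈ insert H T) =>
        (killedForms S p).map (mulForm fun x => equation K x)) H (Finset.mem_insert_self H T) le_rfl
        ⟨m, hmk, rfl⟩

/-- An entire form killed by the equations of `T` becomes a logarithmic form after division by
their product. -/
theorem cut_mulForm_inv_mem_weight {B : CentralArrangement E} {T : Finset (Submodule ℂ E)}
    (hT : ∀ H ∈ T, H ∈ B.hyperplanes) (hind : Independent T) {p : ℕ} {φ : Form E p}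
    (hφ : φ ∈ killedForms T p) :
    cut B.complement (mulForm (fun x => (eqProd T x)⁻¹) φ) ∈ B.weight T.card p := by
  classical
  induction T using Finset.induction_on generalizing p with
  | empty =>
    have : mulForm (fun x => (eqProd (∅ : Finset (Submodule ℂ E)) x)⁻¹) φ = φ :=
      Form.ext fun x => by simp [mulForm_apply, eqProd]
    rw [this]
    exact (IsLogMonomial.holomorphic φ hφ.1).mem_weight (by simp)
  | insert H T hHT ih =>
    have hHB := hT H (Finset.mem_insert_self H T)
    have hHc := B.isCoatom H hHB
    obtain ⟨e, he, heK⟩ := hind.exists_dual (fun K hK => B.isCoatom K (hT K hK))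
      (Finset.mem_insert_self H T)
    obtain ⟨hφa, hφk⟩ := mem_killedForms.mp hφ
    have hφH := hφk H (Finset.mem_insert_self H T)
    cases p with
    | zero =>
      have : φ = 0 := Form.ext fun x => eq_zero_of_wedge_eq_zero he (hφH x)
      rw [this, map_zero, map_zero]; exact zero_mem _
    | succ p =>
      -- `φ = ψ ∧ df_H`, and `ψ` is still killed by the `∧ df_K`, as `e ∈ K` for the other `K`.
      let ψ : Form E p := fun x => (-1 : ℂ) ^ p • (φ x).curryLeft e
      have hψ : ψ ∈ killedForms T p := by
        refine mem_killedForms.mpr ⟨fun x _ => ?_, fun K hK x => ?_⟩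
        · have h1 : AnalyticAt ℂ (fun x => ((ContinuousLinearMap.apply ℂ _ e).comp
              (ContinuousAlternatingMap.curryLeftLI (𝕜 := ℂ) (E := E) (F := ℂ)
                (n := p)).toContinuousLinearMap) (φ x)) x :=
            (ContinuousLinearMap.analyticAt _ _).comp (hφa x trivial)
          exact (analyticAt_const (v := (-1 : ℂ) ^ p)).smul h1
        · have hKH : K ≠ H := fun h => hHT (h ▸ hK)
          have hK' := Finset.mem_insert_of_mem (a := K) (b := H) hK
          have h0 := (equation_eq_zero (B.isCoatom K (hT K hK'))).2 (heK K hK' hKH)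
          change wedge ((-1 : ℂ) ^ p • (φ x).curryLeft e) _ = 0
          rw [wedge_smul, wedge_curryLeft_eq_zero h0 (hφk K hK' x), covector_smul_zero]
      have h1 := wedgeLog_mem_weight hHB (ih (fun K hK => hT K (Finset.mem_insert_of_mem hK))
        (hind.subset (Finset.subset_insert H T)) hψ)
      rw [Finset.card_insert_of_notMem hHT]
      push_cast
      convert h1 using 1
      rw [wedgeLog_cut]
      congr 1
      refine Form.ext fun x => ?_
      rw [wedgeLog_apply, mulForm_apply, mulForm_apply, wedge_smul, logForm_eq_equation hHc,
        wedge_smul_right, ← eq_wedge_of_wedge_eq_zero he (hφH x), smul_smul, eqProd_insert T hHT,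
        mul_inv, mul_comm]

end Relations

end CentralArrangement

end LogForms

namespace LogForms

namespace CentralArrangement

section Regularity

variable {E : Type u} [NormedAddCommGroup E] [NormedSpace ℂ E] [FiniteDimensional ℂ E]

/-! ### Forms regular along the intersection of independent hyperplanes -/

theorem IsLogMonomial.mem_regularPart {B : CentralArrangement E} {I S : Finset (Submodule ℂ E)}
    {k : ℤ} {p : ℕ} {ω : Form E p} (h : B.IsLogMonomial I p ω) (hI : (I.card : ℤ) ≤ k)
    (hSI : ¬ S ⊆ I) : ω ∈ B.regularPart S k p := by
  obtain ⟨H, hHS, hHI⟩ := Finset.not_subset.mp hSI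
  obtain ⟨ω', hω', rfl⟩ := h.exists_deletion hHI
  exact B.map_cut_le_regularPart hHS k p ⟨ω', hω'.mem_weight hI, rfl⟩

/-- The case where the arrangement itself is independent. -/
theorem mem_regularPart_of_independent {B : CentralArrangement E} {S : Finset (Submodule ℂ E)}
    (hS : B.hyperplanes = S) (hind : Independent S) {k : ℤ} {p : ℕ} {ω : Form E p}
    (hω : ω ∈ B.weight k p) (hv : ω ∈ B.vanishing S p) : ω ∈ B.regularPart S k p := by
  have hSB : ∀ H ∈ S, H ∈ B.hyperplanes := fun H hH => hS ▸ hH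
  have hSc : ∀ H ∈ S, IsCoatom H := fun H hH => B.isCoatom H (hSB H hH)
  by_cases hk : (S.card : ℤ) ≤ k
  swap
  · refine weight_induction (fun I τ hI hτ => hτ.mem_regularPart hI fun hSI => hk ?_) hω
    exact le_trans (by exact_mod_cast Finset.card_le_card hSI) hI
  have hle : B.weight k p ≤ B.regularPart S k p ⊔
      (B.weight k p ⊓ ⨅ H ∈ S, LinearMap.ker (wedgeLog H)) := by
    refine weight_induction fun I τ hI hτ => ?_
    by_cases hSI : S ⊆ I
    · refine Submodule.mem_sup_right ⟨hτ.mem_weight hI, ?_⟩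
      simp only [SetLike.mem_coe, Submodule.mem_iInf, LinearMap.mem_ker]
      exact fun H hH => hτ.wedge_eq_zero (hSI hH)
    · exact Submodule.mem_sup_left (hτ.mem_regularPart hI hSI)
  obtain ⟨g, hg, κ, ⟨hκ, hκS⟩, rfl⟩ := Submodule.mem_sup.mp (hle hω)
  refine add_mem hg ?_
  simp only [SetLike.mem_coe, Submodule.mem_iInf, LinearMap.mem_ker] at hκS
  have hκv : κ ∈ B.vanishing S p :=
    (Submodule.add_mem_iff_right _ (B.regularPart_le_vanishing hSB k p hg)).mp hv
  obtain ⟨φ, hφ, he⟩ := exists_extension S hκ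
  have hoff : off (B.hyperplanes \ S) = Set.univ := by
    rw [hS]; ext; simp [off]
  have h0 : ∀ x, (∀ H ∈ S, x ∈ H) → φ x = 0 := fun x hx =>
    eq_zero_of_mem_vanishing hκv hφ.continuousOn he (by rw [hoff]; trivial) hx
  rw [hoff] at hφ
  have hne : ∀ x ∈ B.complement, eqProd S x ≠ 0 := fun x hx =>
    eqProd_ne_zero hSc fun H hH => hx H (hSB H hH)
  have hφk : (φ : Form E p) ∈ killedForms S p := by
    refine mem_killedForms.mpr ⟨hφ, fun H hH x => ?_⟩
    refine eq_of_eq_on_complement B isOpen_univ (φ := fun x => wedge (φ x) (equation H))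
      (ψ := fun _ => 0)
      (fun x _ => (analyticAt_wedge (hφ x trivial) analyticAt_const).continuousAt.continuousWithinAt)
      continuousOn_const (fun y _ hy => ?_) (Set.mem_univ x)
    have hy0 : equation H y ≠ 0 := fun h => hy H (hSB H hH) ((equation_eq_zero (hSc H hH)).1 h)
    have h1 : wedge (κ y) (logForm H y) = 0 := congrFun (hκS H hH) y
    have h2 : wedge (κ y) (equation H) = equation H y • wedge (κ y) (logForm H y) := by
      rw [logForm_eq_equation (hSc H hH), wedge_smul_right, smul_smul, mul_inv_cancel₀ hy0, one_smul]
    rw [he y hy, wedge_smul, h2, h1, covector_smul_zero, covector_smul_zero]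
  have hdiv := mem_iSup_mulForm_of_eq_zero hSc hind subset_rfl hφk h0
  let L : Form E p →ₗ[ℂ] Form E p := cut B.complement ∘ₗ mulForm fun x => (eqProd S x)⁻¹
  have hκφ : κ = L φ := by
    refine Form.ext fun x => ?_
    change κ x = cut B.complement (mulForm (fun x => (eqProd S x)⁻¹) (φ : Form E p)) x
    by_cases hx : x ∈ B.complement
    · rw [cut_of_mem _ hx]
      change κ x = (eqProd S x)⁻¹ • φ x
      rw [he x hx, smul_smul, inv_mul_cancel₀ (hne x hx), one_smul]
    · rw [cut_of_notMem _ hx, holForms_zero (weight_le_holForms _ _ _ hκ) hx]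
  rw [hκφ]
  suffices hL : (⨆ H ∈ S, (killedForms S p).map (mulForm fun x => equation H x)) ≤
      (B.regularPart S k p).comap L from hL hdiv
  refine iSup₂_le fun H hH => ?_
  rintro _ ⟨ψ, hψ, rfl⟩
  have hLψ : L ψ ∈ B.weight k p :=
    B.weight_mono hk p (cut_mulForm_inv_mem_weight hSB hind hψ)
  have hcomm : L (mulForm (fun x => equation H x) ψ) = mulForm (fun x => equation H x) (L ψ) := by
    simp only [L, LinearMap.comp_apply]
    rw [mulForm_cut]
    congr 1
    exact Form.ext fun x => smul_comm _ _ _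
  rw [Submodule.mem_comap, hcomm]
  exact B.map_cut_le_regularPart hH k p (mulForm_equation_mem (hSB H hH) hLψ)

/-- Let `S` be an independent subset of `B` such that no other member of `B` contains its
intersection `F`. A logarithmic form of weight `k` that has, after multiplication by the equations
of the members of `S`, the value zero along `F`, is a sum of logarithmic forms of weight `k`, each
without pole along some member of `S`. -/
theorem mem_regularPart_of_mem_vanishing (B : CentralArrangement E) (S : Finset (Submodule ℂ E))
    (hS : ∀ H ∈ S, H ∈ B.hyperplanes) (hind : Independent S)
    (hF : ∀ Y ∈ B.hyperplanes \ S, ¬ S.inf id ≤ Y) {k : ℤ} {p : ℕ} {ω : Form E p}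
    (hω : ω ∈ B.weight k p) (hv : ω ∈ B.vanishing S p) : ω ∈ B.regularPart S k p := by
  classical
  induction hn : (B.hyperplanes \ S).ncard using Nat.strong_induction_on generalizing B S k p ω with
  | _ n ih =>
  rcases (B.hyperplanes \ S).eq_empty_or_nonempty with hempty | ⟨X, hXB, hXS⟩
  · exact mem_regularPart_of_independent (subset_antisymm (Set.sdiff_eq_empty.mp hempty) hS)
      hind hω hv
  have hXS' : X ∉ S := hXS
  have hfin : (B.hyperplanes \ S).Finite := B.finite.subset Set.sdiff_subset
  have hXF : ¬ S.inf id ≤ X := hF X ⟨hXB, hXS⟩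
  -- The pole along `X` can be removed modulo forms without pole along some member of `S`.
  have hrem : ω ∈ B.regularPart S k p ⊔ ((B.deletion X).weight k p).map (cut B.complement) := by
    by_cases hY : ∃ Y ∈ B.hyperplanes \ S, Y ≠ X ∧ S.inf id ⊓ X ≤ Y
    · obtain ⟨Y, ⟨hYB, hYS⟩, hYX, hle⟩ := hY
      cases p with
      | zero =>
        obtain ⟨β, hβ, rfl⟩ := weight_decomp_zero hXB hω
        exact Submodule.mem_sup_right ⟨β, hβ, rfl⟩
      | succ p =>
        obtain ⟨α, hα, β, hβ, rfl⟩ := weight_decomp_succ hXB hω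
        have h1 := wedgeLog_sub_mem_regularPart hS hXB hXS' hYB hYS hle (cut_mem_weight X hα)
        have h2 := wedgeLog_mem_weight (A := B.deletion X) (X := Y) ⟨hYB, hYX⟩ hα
        rw [sub_add_cancel] at h1 h2
        have e : wedgeLog X α + cut B.complement β =
            -(wedgeLog Y (cut B.complement α) - wedgeLog X (cut B.complement α)) +
              cut B.complement (wedgeLog Y α + β) := by
          rw [map_add, ← wedgeLog_cut_deletion hXB (weight_le_holForms _ _ _ hα), wedgeLog_cut _ Y]
          abel
        rw [e]
        exact Submodule.add_mem_sup (neg_mem h1) ⟨_, add_mem h2 hβ, rfl⟩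
    · -- No other member of `B` outside `S` contains `F ∩ X`, so the induction hypothesis applies to `S ∪ {X}`.
      push Not at hY
      have hS1 : ∀ H ∈ insert X S, H ∈ B.hyperplanes := fun H hH =>
        (Finset.mem_insert.mp hH).elim (fun h => h ▸ hXB) (hS H)
      have hsub : B.hyperplanes \ (insert X S : Finset _) ⊆ B.hyperplanes \ S := by
        rintro Y ⟨hYB, hYS⟩
        exact ⟨hYB, fun h => hYS (Finset.mem_insert_of_mem h)⟩
      -- The extension for `S ∪ {X}` is `f_X` times the one for `S` off `X`, so it vanishes on `F`
      -- off `X`, and on `F ∩ X` by density.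
      have hv1 : ω ∈ B.vanishing (insert X S) p := by
        obtain ⟨φ, hφ, he⟩ := exists_extension (insert X S) hω
        obtain ⟨ψ, hψ, hψe, hψ0⟩ := hv
        have hopen : IsOpen (off (B.hyperplanes \ S)) := isOpen_off hfin
        have hφψ : ∀ x ∈ off (B.hyperplanes \ S), φ x = equation X x • ψ x := by
          intro x hx
          refine eq_of_eq_on_complement B hopen (hφ.continuousOn.mono (off_anti hsub))
            (ψ := fun x => equation X x • ψ x) ((equation X).continuous.continuousOn.smul hψ)
            (fun y _ hyB => ?_) hx
          rw [he y hyB, hψe y hyB, smul_smul, eqProd_insert S hXS']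
        refine ⟨φ, hφ.continuousOn, he, fun x hx hxS => ?_⟩
        refine eq_of_eq_on_off (F := S.inf id) hfin hF
          (isOpen_off (hfin.subset hsub)) hφ.continuousOn (ψ := fun _ => 0) continuousOn_const
          (fun y _ hyF hy => ?_) hx
          (Submodule.mem_finsetInf.mpr fun H hH => hxS H (Finset.mem_insert_of_mem hH))
        rw [hφψ y hy, hψ0 y hy fun H hH => Submodule.mem_finsetInf.mp hyF H hH, covector_smul_zero]
      have h1 := ih _ (hn ▸ Set.ncard_lt_ncard ⟨hsub, fun h => (h ⟨hXB, hXS⟩).2 (by simp)⟩ hfin) B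
        (insert X S) hS1 (hind.insert (B.isCoatom X hXB) hXF)
        (fun Y hY' => by
          rw [Finset.inf_insert, inf_comm]
          refine hY Y (hsub hY') fun h => hY'.2 (by simp [h])) hω hv1 rfl
      rw [regularPart, Finset.iSup_insert] at h1
      rwa [regularPart, sup_comm]
  obtain ⟨g, hg, _, ⟨ω', hω', rfl⟩, rfl⟩ := Submodule.mem_sup.mp hrem
  refine add_mem hg (cut_mem_regularPart X ?_)
  have hS' : ∀ H ∈ S, H ∈ (B.deletion X).hyperplanes := fun H hH =>
    ⟨hS H hH, fun h => hXS' (Set.mem_singleton_iff.mp h ▸ hH)⟩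
  have hsub : (B.deletion X).hyperplanes \ S ⊆ B.hyperplanes \ S := fun Y hY => ⟨hY.1.1, hY.2⟩
  have hv' : cut B.complement ω' ∈ B.vanishing S p :=
    (Submodule.add_mem_iff_right _ (B.regularPart_le_vanishing hS k p hg)).mp hv
  refine ih _ (hn ▸ Set.ncard_lt_ncard ⟨hsub, fun h => (h ⟨hXB, hXS⟩).1.2 rfl⟩ hfin)
    (B.deletion X) S hS' hind (fun Y hY => hF Y (hsub hY)) hω' ?_ rfl
  obtain ⟨φ, hφ, he⟩ := exists_extension S hω'
  refine ⟨φ, hφ.continuousOn, he, fun x hx hxS => ?_⟩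
  have hz : ∀ y ∈ off (B.hyperplanes \ S), (∀ H ∈ S, y ∈ H) → φ y = 0 := fun y hy hyS =>
    eq_zero_of_mem_vanishing hv' (hφ.continuousOn.mono (off_anti hsub))
      (fun z hz => by rw [he z (B.complement_subset_deletion X hz), cut_of_mem _ hz]) hy hyS
  exact eq_of_eq_on_off (F := S.inf id) hfin hF (isOpen_off (hfin.subset hsub)) hφ.continuousOn
    (ψ := fun _ => 0) continuousOn_const
    (fun y _ hyF hy => hz y hy fun H hH => Submodule.mem_finsetInf.mp hyF H hH) hx
    (Submodule.mem_finsetInf.mpr hxS)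

/-! ### Exactness in each degree -/

theorem independent_singleton {H : Submodule ℂ E} (hH : IsCoatom H) : Independent {H} := by
  obtain ⟨e, he⟩ := exists_equation_eq_one hH
  intro K hK
  rw [Finset.mem_singleton.mp hK]
  refine ⟨e, fun h => ?_, fun K' hK' hne => absurd (Finset.mem_singleton.mp hK') hne⟩
  rw [← equation_eq_zero hH, he] at h
  exact one_ne_zero h

/-- A form whose residue along `H` vanishes has no pole along `H`, with the same weight. -/
theorem mem_map_cut_of_pull_eq_zero {A : CentralArrangement E} {H : Submodule ℂ E}
    (hH : H ∈ A.hyperplanes) {k : ℤ} {p : ℕ} {ω : Form E (p + 1)} (hω : ω ∈ A.weight k (p + 1))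
    {α : Form E p} {β : Form E (p + 1)} (hα : α ∈ holForms (A.deletion H).complement p)
    (hβ : β ∈ holForms (A.deletion H).complement (p + 1))
    (h : ω = wedgeLog H α + cut A.complement β) (h0 : pull H α = 0) :
    ω ∈ ((A.deletion H).weight k (p + 1)).map (cut A.complement) := by
  have hc := A.isCoatom H hH
  obtain ⟨e, he⟩ := exists_equation_eq_one hc
  have hset : A.hyperplanes \ ({H} : Finset (Submodule ℂ E)) = (A.deletion H).hyperplanes := by
    simp [deletion]
  have h1 : ω ∈ A.regularPart {H} k (p + 1) := by
    refine A.mem_regularPart_of_mem_vanishing {H} (by simpa using hH) (independent_singleton hc) ?_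
      hω ?_
    · rintro Y ⟨hYA, hYH⟩ hle
      rw [Finset.inf_singleton, id] at hle
      rcases hc.le_iff.mp hle with h | h
      · exact (A.isCoatom Y hYA).1 h
      · exact hYH (by simp [h])
    · refine ⟨fun x => wedge (α x) (equation H) + equation H x • β x, ?_, fun x hx => ?_,
        fun x hx hxH => ?_⟩
      · intro x hx
        rw [hset] at hx
        exact ((analyticAt_wedge (holForms_analyticAt hα hx) analyticAt_const).add
          ((analyticAt_equation H x).smul
            (holForms_analyticAt hβ hx))).continuousAt.continuousWithinAt
      · have hx0 : equation H x ≠ 0 := fun h => hx H hH ((equation_eq_zero hc).1 h)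
        have hp : eqProd {H} x = equation H x := by simp [eqProd]
        rw [h, Form.add_apply, wedgeLog_apply, cut_of_mem _ hx, logForm_eq_equation hc, hp,
          wedge_smul_right, smul_add, smul_smul, mul_inv_cancel₀ hx0, one_smul]
      · have hxH' : x ∈ H := hxH H (by simp)
        have h2 : pull H α ⟨x, hxH'⟩ = 0 := congrFun h0 _
        have h3 := wedge_eq_zero_of_comp_eq_zero (ker_equation hc) he h2
        change wedge (α x) (equation H) + equation H x • β x = 0
        rw [h3, (equation_eq_zero hc).2 hxH', covector_zero_smul, add_zero]
  simpa [regularPart] using h1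

/-- A holomorphic form on the complement of the deletion is determined by its restriction to the
complement of the arrangement, which is dense. -/
theorem cut_injective {A : CentralArrangement E} {H : Submodule ℂ E} {p : ℕ} {ω : Form E p}
    (hω : ω ∈ holForms (A.deletion H).complement p) (h : cut A.complement ω = 0) : ω = 0 := by
  refine Form.ext fun x => ?_
  by_cases hx : x ∈ (A.deletion H).complement
  · refine eq_of_eq_on_complement A (A.deletion H).isOpen_complement (φ := ω) (ψ := fun _ => 0)
      (fun y hy => (holForms_analyticAt hω hy).continuousAt.continuousWithinAt) continuousOn_const
      (fun y _ hy => ?_) hx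
    rw [← cut_of_mem ω hy, h, Form.zero_apply]
  · rw [holForms_zero hω hx, Form.zero_apply]

/-- Every logarithmic form on the restriction is the restriction of a logarithmic form of the same
weight along the deletion. -/
theorem exists_pull_eq {A : CentralArrangement E} {H : Submodule ℂ E} (hH : H ∈ A.hyperplanes)
    {k : ℤ} {p : ℕ} {σ : Form H p} (hσ : σ ∈ (A.restriction hH).weight k p) :
    σ ∈ ((A.deletion H).weight k p).map (pull H) := by
  revert σ
  change (A.restriction hH).weight k p ≤ _
  refine weight_induction fun I σ hI hσ => Submodule.map_mono (weight_mono _ hI _) ?_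
  clear hI
  induction hσ with
  | @holomorphic p η hη =>
    obtain ⟨π, hπ⟩ := Submodule.ClosedComplemented.of_finiteDimensional H
    let ζ : Form E p := fun x => (η (π x)).compContinuousLinearMap π
    have hζ : ζ ∈ holForms Set.univ p := by
      refine ⟨fun x _ => ?_, fun x hx => absurd trivial hx⟩
      exact AnalyticAt.comp (g := (ContinuousAlternatingMap.compContinuousLinearMapCLM π :
        (H [⋀^Fin p]→L[ℂ] ℂ) →L[ℂ] (E [⋀^Fin p]→L[ℂ] ℂ))) (ContinuousLinearMap.analyticAt _ _)
        (AnalyticAt.comp (g := (η : H → H [⋀^Fin p]→L[ℂ] ℂ)) (hη.1 _ trivial) (π.analyticAt x))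
    refine ⟨_, (IsLogMonomial.holomorphic ζ hζ).mem_weight (by simp), ?_⟩
    rw [pull_cut, ← complement_restriction A hH]
    congr 1
    refine Form.ext fun x => ?_
    change ((η (π x)).compContinuousLinearMap π).compContinuousLinearMap H.subtypeL = η x
    ext v
    simp [ContinuousAlternatingMap.compContinuousLinearMap_apply, hπ, Function.comp_def]
  | @wedge I p σ X hX hXI h ih =>
    obtain ⟨Y, hY, rfl⟩ := hX
    obtain ⟨α, hα, rfl⟩ := ih
    rw [Finset.card_cons, Nat.cast_succ]
    exact ⟨_, wedgeLog_mem_weight (A := A.deletion H) hY hα, pull_wedgeLog (A.isCoatom Y hY.1) α⟩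

end Regularity

end CentralArrangement

end LogForms

namespace LogForms

open CategoryTheory

namespace CentralArrangement

section ShortExact

variable {E : Type u} [NormedAddCommGroup E] [NormedSpace ℂ E] [FiniteDimensional ℂ E]

/-! ### Short exact sequences of complexes -/

theorem shortExact_of_linear {S : ShortComplex (CochainComplex (ModuleCat.{u} ℂ) ℕ)}
    (hinj : ∀ p, Function.Injective (S.f.f p).hom) (hsurj : ∀ p, Function.Surjective (S.g.f p).hom)
    (hex : ∀ p x, (S.g.f p).hom x = 0 → ∃ y, (S.f.f p).hom y = x) : S.ShortExact := by
  refine HomologicalComplex.shortExact_of_degreewise_shortExact S fun p => ?_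
  have hf : Mono (S.f.f p) := (ModuleCat.mono_iff_injective _).mpr (hinj p)
  have hg : Epi (S.g.f p) := (ModuleCat.epi_iff_surjective _).mpr (hsurj p)
  exact { exact := (ShortComplex.moduleCat_exact_iff _).mpr (hex p), mono_f := hf, epi_g := hg }

variable (A : CentralArrangement E) {H : Submodule ℂ E} (hH : H ∈ A.hyperplanes)

theorem inclWeight_injective (k : ℤ) (p : ℕ) : Function.Injective (A.inclWeight H k p) := by
  refine (injective_iff_map_eq_zero _).mpr fun ω h => Subtype.ext ?_
  exact cut_injective ((A.deletion H).weight_le_holForms k p ω.2) (congrArg Subtype.val h)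

theorem weightResidue_surjective (k : ℤ) (p : ℕ) : Function.Surjective (A.weightResidue hH k p) := by
  intro σ
  obtain ⟨α, hα, hασ⟩ := exists_pull_eq hH σ.2
  have hc : (2 * Real.pi * Complex.I : ℂ) ≠ 0 := Complex.two_pi_I_ne_zero
  set c := (2 * Real.pi * Complex.I : ℂ) with hcdef
  have hα' : c⁻¹ • α ∈ (A.deletion H).weight (k - 1) p := Submodule.smul_mem _ _ hα
  have hω : wedgeLog H (c⁻¹ • α) ∈ A.weight k (p + 1) := by
    have := wedgeLog_mem_weight hH (cut_mem_weight H hα')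
    rwa [sub_add_cancel, wedgeLog_cut_deletion hH (weight_le_holForms _ _ _ hα')] at this
  refine ⟨⟨_, hω⟩, Subtype.ext ?_⟩
  refine (A.residue_eq hH ⟨_, A.weight_le_logForms _ _ hω⟩ (weight_le_logForms _ _ _ hα')
    (zero_mem _) (by rw [map_zero, add_zero])).trans ?_
  rw [map_smul, hασ, ← hcdef, smul_smul, mul_inv_cancel₀ hc, one_smul]

theorem exists_inclWeight_eq (k : ℤ) (p : ℕ) (ω : A.weight k (p + 1))
    (h : A.weightResidue hH k p ω = 0) : ∃ β, A.inclWeight H k (p + 1) β = ω := by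
  obtain ⟨α, hα, β, hβ, e⟩ := weight_decomp_succ hH ω.2
  have h1 : (2 * Real.pi * Complex.I : ℂ) • pull H α = 0 :=
    (A.residue_eq hH ⟨ω.1, A.weight_le_logForms _ _ ω.2⟩ (weight_le_logForms _ _ _ hα)
      (weight_le_logForms _ _ _ hβ) e).symm.trans (congrArg Subtype.val h)
  have h2 := (smul_eq_zero.mp h1).resolve_left Complex.two_pi_I_ne_zero
  obtain ⟨γ, hγ, hγω⟩ := mem_map_cut_of_pull_eq_zero hH ω.2 (weight_le_holForms _ _ _ hα)
    (weight_le_holForms _ _ _ hβ) e h2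
  exact ⟨⟨γ, hγ⟩, Subtype.ext hγω⟩

theorem exists_inclWeight_zero_eq (hH : H ∈ A.hyperplanes) (k : ℤ) (ω : A.weight k 0) :
    ∃ β, A.inclWeight H k 0 β = ω := by
  obtain ⟨β, hβ, e⟩ := weight_decomp_zero hH ω.2
  exact ⟨⟨β, hβ⟩, Subtype.ext e.symm⟩

theorem weightSeq_shortExact (k : ℤ) : (A.weightSeq hH k).ShortExact :=
  shortExact_of_linear (A.inclWeight_injective k)
    (fun
      | 0 => fun _ => ⟨0, rfl⟩
      | p + 1 => A.weightResidue_surjective hH k p)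
    fun
      | 0 => fun ω _ => A.exists_inclWeight_zero_eq hH k ω
      | p + 1 => A.exists_inclWeight_eq hH k p

theorem residue_surjective (p : ℕ) : Function.Surjective (A.residue hH p) := by
  intro σ
  obtain ⟨k, hk⟩ := exists_mem_weight σ.2
  rw [← add_sub_cancel_right k 1] at hk
  obtain ⟨ω, hω⟩ := A.weightResidue_surjective hH (k + 1) p ⟨σ.1, hk⟩
  have h : (A.weightResidue hH (k + 1) p ω).1 = σ.1 := congrArg Subtype.val hω
  exact ⟨⟨ω.1, A.weight_le_logForms _ _ ω.2⟩, Subtype.ext h⟩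

theorem exists_inclForms_eq (p : ℕ) (ω : A.logForms (p + 1)) (h : A.residue hH p ω = 0) :
    ∃ β, A.inclForms H (p + 1) β = ω := by
  obtain ⟨k, hk⟩ := exists_mem_weight ω.2
  have h1 : (A.residue hH p ω).1 = 0 := congrArg Subtype.val h
  obtain ⟨β, hβ⟩ := A.exists_inclWeight_eq hH k p ⟨ω.1, hk⟩ (Subtype.ext h1)
  have h2 : cut A.complement β.1 = ω.1 := congrArg Subtype.val hβ
  exact ⟨⟨β.1, weight_le_logForms _ _ _ β.2⟩, Subtype.ext h2⟩

theorem exists_inclForms_zero_eq (hH : H ∈ A.hyperplanes) (ω : A.logForms 0) :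
    ∃ β, A.inclForms H 0 β = ω := by
  obtain ⟨k, hk⟩ := exists_mem_weight ω.2
  obtain ⟨β, hβ⟩ := A.exists_inclWeight_zero_eq hH k ⟨ω.1, hk⟩
  have h2 : cut A.complement β.1 = ω.1 := congrArg Subtype.val hβ
  exact ⟨⟨β.1, weight_le_logForms _ _ _ β.2⟩, Subtype.ext h2⟩

theorem inclForms_injective (p : ℕ) : Function.Injective (A.inclForms H p) := by
  refine (injective_iff_map_eq_zero _).mpr fun ω h => Subtype.ext ?_
  exact cut_injective ((A.deletion H).logForms_le_holForms p ω.2) (congrArg Subtype.val h)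

theorem logSeq_shortExact : (A.logSeq hH).ShortExact :=
  shortExact_of_linear A.inclForms_injective
    (fun
      | 0 => fun _ => ⟨0, rfl⟩
      | p + 1 => A.residue_surjective hH p)
    fun
      | 0 => fun ω _ => A.exists_inclForms_zero_eq hH ω
      | p + 1 => A.exists_inclForms_eq hH p

/-- The inclusion is strictly compatible with the weight filtrations. -/
theorem mem_weight_of_cut_mem_weight (hH : H ∈ A.hyperplanes) {k l : ℤ} {p : ℕ} {ω : Form E p}
    (hω : ω ∈ (A.deletion H).weight l p) (h : cut A.complement ω ∈ A.weight k p) :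
    ω ∈ (A.deletion H).weight k p := by
  obtain ⟨β, hβ⟩ : ∃ β, A.inclWeight H k p β = ⟨_, h⟩ := by
    cases p with
    | zero => exact A.exists_inclWeight_zero_eq hH k _
    | succ p =>
      have h0 : (A.residue hH p ⟨_, A.weight_le_logForms _ _ h⟩).1 = 0 :=
        congrArg Subtype.val (A.residue_cut hH _ (weight_le_logForms _ _ _ hω) rfl)
      exact A.exists_inclWeight_eq hH k p _ (Subtype.ext h0)
  have h1 : cut A.complement β.1 = cut A.complement ω := congrArg Subtype.val hβ
  have h2 : β.1 - ω = 0 := by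
    refine cut_injective (A := A) (H := H)
      (sub_mem (weight_le_holForms _ _ _ β.2) (weight_le_holForms _ _ _ hω)) ?_
    rw [map_sub, h1, sub_self]
  rw [← sub_eq_zero.mp h2]
  exact β.2

theorem grIncl_injective (hH : H ∈ A.hyperplanes) (k : ℤ) (p : ℕ) :
    Function.Injective ((A.grIncl H k).f p).hom := by
  refine (injective_iff_map_eq_zero _).mpr fun x h => ?_
  obtain ⟨(ω : (A.deletion H).weight k p), rfl⟩ := Submodule.Quotient.mk_surjective _ x
  obtain ⟨(ω' : A.weight (k - 1) p), hω'⟩ := (Submodule.Quotient.mk_eq_zero _).mp h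
  have h1 : ω'.1 = cut A.complement ω.1 := congrArg Subtype.val hω'
  have h2 : ω.1 ∈ (A.deletion H).weight (k - 1) p :=
    A.mem_weight_of_cut_mem_weight hH ω.2 (h1 ▸ ω'.2)
  exact (Submodule.Quotient.mk_eq_zero _).mpr
    ⟨(⟨ω.1, h2⟩ : (A.deletion H).weight (k - 1) p), Subtype.ext rfl⟩

theorem exists_grIncl_eq (k : ℤ) (p : ℕ) (x : (A.grComplex k).X (p + 1))
    (h : ((A.grRes hH k).f (p + 1)).hom x = 0) : ∃ y, ((A.grIncl H k).f (p + 1)).hom y = x := by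
  obtain ⟨(ω : A.weight k (p + 1)), rfl⟩ := Submodule.Quotient.mk_surjective _ x
  obtain ⟨(σ : (A.restriction hH).weight (k - 1 - 1) p), hσ⟩ :=
    (Submodule.Quotient.mk_eq_zero _).mp h
  obtain ⟨ω', rfl⟩ := A.weightResidue_surjective hH (k - 1) p σ
  -- The residue of `ω` lifts to a form `ω'` of weight `k - 1`; only `ω - ω'` has residue zero.
  let ω₁ : A.weight k (p + 1) := ⟨ω'.1, A.weight_mono (sub_le_self k zero_le_one) _ ω'.2⟩
  have h1 : A.weightResidue hH k p ω₁ = A.weightResidue hH k p ω :=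
    Subtype.ext (congrArg Subtype.val hσ)
  obtain ⟨β, hβ⟩ := A.exists_inclWeight_eq hH k p (ω - ω₁) (by rw [map_sub, h1, sub_self])
  refine ⟨Submodule.Quotient.mk β, (Submodule.Quotient.eq _).mpr ⟨-ω', ?_⟩⟩
  refine Eq.trans ?_ (congrArg (fun τ => τ - ω) hβ).symm
  refine Subtype.ext ?_
  change -ω'.1 = ω.1 - ω'.1 - ω.1
  abel

theorem grSeq_shortExact (k : ℤ) : (A.grSeq hH k).ShortExact :=
  shortExact_of_linear (A.grIncl_injective hH k)
    (fun
      | 0 => fun _ => ⟨0, rfl⟩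
      | p + 1 => fun y => by
        obtain ⟨σ, rfl⟩ := Submodule.Quotient.mk_surjective _ y
        obtain ⟨ω, rfl⟩ := A.weightResidue_surjective hH k p σ
        exact ⟨Submodule.Quotient.mk ω, rfl⟩)
    fun
      | 0 => fun x _ => by
        obtain ⟨ω, rfl⟩ := Submodule.Quotient.mk_surjective _ x
        obtain ⟨β, rfl⟩ := A.exists_inclWeight_zero_eq hH k ω
        exact ⟨Submodule.Quotient.mk β, rfl⟩
      | p + 1 => A.exists_grIncl_eq hH k p

end ShortExact

end CentralArrangement

end LogForms

theorem theorem3p5 {E : Type u} [NormedAddCommGroup E] [NormedSpace ℂ E] [FiniteDimensional ℂ E]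
    (A : LogForms.CentralArrangement E) {H : Submodule ℂ E} (hH : H ∈ A.hyperplanes) :
    (A.logSeq hH).ShortExact ∧
      (∀ k : ℤ, (A.weightSeq hH k).ShortExact) ∧
      (∀ k : ℤ, (A.grSeq hH k).ShortExact) :=
  ⟨A.logSeq_shortExact hH, A.weightSeq_shortExact hH, A.grSeq_shortExact hH⟩
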